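/- Let $n\ge 1$ and let $M$ be a non-empty smooth manifold of dimension $2n+1$. Let $(\phi,\xi,\eta,g)$ be a para-Sasakian structure on $M$. That is, $\phi$ is a smooth $(1,1)$-tensor field, $\xi$ a smooth vector field, $\eta$ a smooth 1-form and $g$ a pseudo-Riemannian metric such that $$\phi^2=I-\eta\otimes\xi,\qquad \eta(\xi)=1,\qquad g(\phi X,\phi Y)=-g(X,Y)+\eta(X)\eta(Y),$$ the eigenspaces of $\phi|_{\ker\eta}$ for the eigenvalues $1$ and $-1$ both have dimension $n$ at every point, and $$(\nabla_X\phi)Y=-g(X,Y)\xi+\eta(Y)X$$ for all vector fields $X,Y$, where $\nabla$ is the Levi-Civita connection of $g$. Let $S$ be the Ricci tensor of $g$, $S(Y,Z)=\operatorname{tr}(X\mapsto R(X,Y)Z)$ with $R(X,Y)Z=\nabla_X\nabla_YZ-\nabla_Y\nabla_XZ-\nabla_{[X,Y]}Z$. Suppose that $g$ is a conformal $\eta$-Ricci soliton: there are a smooth vector field $V$ and real constants $p,\lambda,\mu$ with $$\mathcal L_Vg+2S+\Big[2\lambda-\Big(p+\frac{2}{2n+1}\Big)\Big]g+2\mu\,\eta\otimes\eta=0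 .$$ Then $M$ is $\eta$-Einstein (that is, $S=a\,g+b\,\eta\otimes\eta$ for smooth functions $a,b$ on $M$), and at least one of the following two equalities holds: 1. $\lambda=\frac p2+\frac1{2n+1}+2n-\mu$; 2. $\lambda=\frac p2+\frac1{2n+1}-2n+\mu-4$. Whenever (1) holds, $S=(\mu-2n)g-\mu\,\eta\otimes\eta$ and $V$ is Killing, i.e. $\mathcal L_Vg=0$. Whenever (2) holds, $S=2g-2(n+1)\,\eta\otimes\eta$ and $V$ leaves $\phi$ invariant, i.e. $\mathcal L_V\phi=0$. -/

import Mathlib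

open scoped Manifold ContDiff Bundle
open VectorField FiberBundle

noncomputable section

namespace ParaSasaki

section Geometry

variable {m : ℕ} {M : Type*} [TopologicalSpace M] [ChartedSpace (EuclideanSpace ℝ (Fin m)) M]

/-- (Not necessarily continuous) vector fields on the `m`-dimensional manifold `M`. -/
abbrev VField (m : ℕ) (M : Type*) [TopologicalSpace M]
    [ChartedSpace (EuclideanSpace ℝ (Fin m)) M] : Type _ :=
  (x : M) → TangentSpace (𝓡 m) x

/-- The derivative `X f` of a function `f` in the direction of a vector field `X`. -/
def dirDeriv (X : VField m M) (f : M → ℝ) (x : M) : ℝ :=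
  mvfderiv (𝓡 m) f x (X x)

/-- The Lie bracket `[X, Y]` of vector fields. -/
abbrev bracket (X Y : VField m M) : VField m M := mlieBracket (𝓡 m) X Y

variable [IsManifold (𝓡 m) ∞ M]

/-- `X` is a smooth vector field. -/
def SmoothField (X : VField m M) : Prop :=
  ContMDiff (𝓡 m) ((𝓡 m).prod 𝓘(ℝ, EuclideanSpace ℝ (Fin m))) ∞
    (fun x ↦ Bundle.TotalSpace.mk' (EuclideanSpace ℝ (Fin m)) x (X x))

/-- `X` is differentiable at the point `x`. -/
def DiffFieldAt (X : VField m M) (x : M) : Prop :=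
  MDifferentiableAt (𝓡 m) ((𝓡 m).prod 𝓘(ℝ, EuclideanSpace ℝ (Fin m)))
    (fun y ↦ Bundle.TotalSpace.mk' (EuclideanSpace ℝ (Fin m)) y (X y)) x

/-- A smooth pseudo-Riemannian metric: a smooth field of symmetric nondegenerate bilinear forms
on the tangent spaces. -/
structure PseudoMetric (m : ℕ) (M : Type*) [TopologicalSpace M]
    [ChartedSpace (EuclideanSpace ℝ (Fin m)) M] [IsManifold (𝓡 m) ∞ M] where
  /-- the bilinear form on each tangent space -/
  val : (x : M) → TangentSpace (𝓡 m) x →L[ℝ] TangentSpace (𝓡 m) x →L[ℝ] ℝ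
  symm : ∀ x u v, val x u v = val x v u
  nondegenerate : ∀ x u, (∀ v, val x u v = 0) → u = 0
  contMDiff : ContMDiff (𝓡 m)
    ((𝓡 m).prod 𝓘(ℝ, EuclideanSpace ℝ (Fin m) →L[ℝ] EuclideanSpace ℝ (Fin m) →L[ℝ] ℝ)) ∞
    (fun x ↦ Bundle.TotalSpace.mk'
      (EuclideanSpace ℝ (Fin m) →L[ℝ] EuclideanSpace ℝ (Fin m) →L[ℝ] ℝ)
      (E := fun x ↦ TangentSpace (𝓡 m) x →L[ℝ] TangentSpace (𝓡 m) x →L[ℝ] ℝ) x (val x))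

namespace PseudoMetric

variable (g : PseudoMetric m M)

/-- The function `g(X, Y)`. -/
def app (X Y : VField m M) (x : M) : ℝ := g.val x (X x) (Y x)

/-- The right-hand side of the Koszul formula
`2 g(∇_X Y, Z) = X g(Y,Z) + Y g(X,Z) - Z g(X,Y) + g([X,Y],Z) - g([X,Z],Y) - g([Y,Z],X)`. -/
def koszul (X Y Z : VField m M) (x : M) : ℝ :=
  dirDeriv X (g.app Y Z) x + dirDeriv Y (g.app X Z) x - dirDeriv Z (g.app X Y) x
    + g.app (bracket X Y) Z x - g.app (bracket X Z) Y x - g.app (bracket Y Z) X x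

/-- The Levi-Civita covariant derivative `∇_X Y` of the metric: its value at `x` is the vector
determined by the Koszul formula. For `X`, `Y` differentiable at `x`, this vector exists and is
unique, see `existsUnique_koszul` below. -/
def nabla (X Y : VField m M) : VField m M := fun x ↦
  Classical.epsilon fun v : TangentSpace (𝓡 m) x ↦
    ∀ Z : VField m M, DiffFieldAt Z x → 2 * g.val x v (Z x) = g.koszul X Y Z x

theorem mdifferentiableAt_app {Y Z : VField m M} {x : M} (hY : DiffFieldAt Y x)
    (hZ : DiffFieldAt Z x) : MDifferentiableAt (𝓡 m) 𝓘(ℝ, ℝ) (g.app Y Z) x := by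
  have hg : MDifferentiableAt (𝓡 m) _ _ x := (g.contMDiff x).mdifferentiableAt (by simp)
  have : MDifferentiableAt (𝓡 m) ((𝓡 m).prod 𝓘(ℝ, ℝ))
      (fun y ↦ Bundle.TotalSpace.mk' ℝ (E := Bundle.Trivial M ℝ) y (g.val y (Y y) (Z y))) x := by
    apply MDifferentiableAt.clm_bundle_apply₂ (F₁ := EuclideanSpace ℝ (Fin m))
      (F₂ := EuclideanSpace ℝ (Fin m)) (b := fun y ↦ y)
    · exact hg
    · exact hY
    · exact hZ
  rw [mdifferentiableAt_totalSpace] at this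
  exact this.2

theorem tensorialAt_koszul {X Y : VField m M} {x : M} (hX : DiffFieldAt X x)
    (hY : DiffFieldAt Y x) :
    TensorialAt (𝓡 m) (EuclideanSpace ℝ (Fin m)) (fun Z ↦ g.koszul X Y Z x) x where
  smul {f Z} hf hZ := by
    have e1 : ∀ W : VField m M, g.app W (f • Z) = fun y ↦ f y * g.app W Z y := by
      intro W; funext y; simp [app]
    simp only [koszul, dirDeriv, e1]
    rw [mvfderiv_fun_mul hf (g.mdifferentiableAt_app hY hZ),
      mvfderiv_fun_mul hf (g.mdifferentiableAt_app hX hZ)]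
    simp only [app, bracket]
    rw [mlieBracket_smul_right hf hZ, mlieBracket_smul_right hf hZ]
    simp [g.symm x (Z x) (X x), g.symm x (Z x) (Y x)]
    ring
  add {Z Z'} hZ hZ' := by
    have e1 : ∀ W : VField m M, g.app W (Z + Z') = fun y ↦ g.app W Z y + g.app W Z' y := by
      intro W; funext y; simp [app]
    simp only [koszul, dirDeriv, e1]
    rw [mvfderiv_fun_add (g.mdifferentiableAt_app hY hZ) (g.mdifferentiableAt_app hY hZ'),
      mvfderiv_fun_add (g.mdifferentiableAt_app hX hZ) (g.mdifferentiableAt_app hX hZ')]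
    simp only [app, bracket]
    rw [mlieBracket_add_right hZ hZ', mlieBracket_add_right hZ hZ']
    simp
    ring

/-- The Koszul formula determines a unique vector. -/
theorem existsUnique_koszul {X Y : VField m M} {x : M} (hX : DiffFieldAt X x)
    (hY : DiffFieldAt Y x) :
    ∃! v : TangentSpace (𝓡 m) x,
      ∀ Z : VField m M, DiffFieldAt Z x → 2 * g.val x v (Z x) = g.koszul X Y Z x := by
  have hT := g.tensorialAt_koszul hX hY
  have : FiniteDimensional ℝ (TangentSpace (𝓡 m) x) :=
    inferInstanceAs (FiniteDimensional ℝ (EuclideanSpace ℝ (Fin m)))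
  let B : TangentSpace (𝓡 m) x →ₗ[ℝ] Module.Dual ℝ (TangentSpace (𝓡 m) x) :=
    { toFun := fun u ↦ (g.val x u).toLinearMap
      map_add' := fun u v ↦ by ext; simp
      map_smul' := fun c u ↦ by ext; simp }
  have hB : Function.Injective B := by
    rw [injective_iff_map_eq_zero]
    intro u hu
    exact g.nondegenerate x u fun v ↦ LinearMap.congr_fun hu v
  have hS : Function.Surjective B :=
    (LinearMap.injective_iff_surjective_of_finrank_eq_finrank
      (Subspace.dual_finrank_eq).symm).1 hB
  obtain ⟨v, hv⟩ := hS (((1 / 2 : ℝ) • TensorialAt.mkHom _ x hT).toLinearMap)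
  refine ⟨v, fun Z hZ ↦ ?_, fun w hw ↦ ?_⟩
  · have h1 := LinearMap.congr_fun hv (Z x)
    have h2 := TensorialAt.mkHom_apply hT hZ
    have h3 : g.val x v (Z x) = 1 / 2 * TensorialAt.mkHom _ x hT (Z x) := by
      simpa [B] using h1
    rw [h3, h2]
    ring
  · refine sub_eq_zero.1 (g.nondegenerate x _ fun u ↦ ?_)
    have hu : DiffFieldAt (extend (EuclideanSpace ℝ (Fin m)) u) x := mdifferentiableAt_extend ..
    have h1 := LinearMap.congr_fun hv u
    have h2 := TensorialAt.mkHom_apply hT hu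
    have h3 : g.val x v u = 1 / 2 * TensorialAt.mkHom _ x hT u := by
      simpa [B] using h1
    have h4 := hw _ hu
    rw [extend_apply_self] at h2 h4
    rw [h2] at h3
    simp only [map_sub, sub_apply]
    linarith

theorem nabla_spec {X Y : VField m M} {x : M} (hX : DiffFieldAt X x) (hY : DiffFieldAt Y x)
    {Z : VField m M} (hZ : DiffFieldAt Z x) :
    2 * g.val x (g.nabla X Y x) (Z x) = g.koszul X Y Z x :=
  Classical.epsilon_spec (g.existsUnique_koszul hX hY).exists Z hZ

/-- The curvature `R(X, Y) Z = ∇_X ∇_Y Z - ∇_Y ∇_X Z - ∇_[X,Y] Z` on vector fields. -/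
def curvature (X Y Z : VField m M) : VField m M := fun x ↦
  g.nabla X (g.nabla Y Z) x - g.nabla Y (g.nabla X Z) x - g.nabla (bracket X Y) Z x

/-- The curvature tensor `R(u, v) w` at a point: the curvature of vector fields which are smooth
near `x` and have the values `u`, `v`, `w` at `x`. -/
def curvatureAt (x : M) (u v w : TangentSpace (𝓡 m) x) : TangentSpace (𝓡 m) x :=
  g.curvature (extend (EuclideanSpace ℝ (Fin m)) u) (extend (EuclideanSpace ℝ (Fin m)) v)
    (extend (EuclideanSpace ℝ (Fin m)) w) x

/-- A basis of the tangent space at `x`, used to compute traces. -/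
def tangentBasis (x : M) : Module.Basis (Fin m) ℝ (TangentSpace (𝓡 m) x) :=
  (EuclideanSpace.basisFun (Fin m) ℝ).toBasis

/-- The Ricci tensor: `S(v, w)` is the trace of `u ↦ R(u, v) w`. -/
def ricci (x : M) (v w : TangentSpace (𝓡 m) x) : ℝ :=
  ∑ i, (tangentBasis x).coord i (g.curvatureAt x (tangentBasis x i) v w)

/-- The Lie derivative of the metric,
`(L_V g)(X, Y) = V g(X, Y) - g([V, X], Y) - g(X, [V, Y])`. -/
def lieDeriv (V X Y : VField m M) (x : M) : ℝ :=
  dirDeriv V (g.app X Y) x - g.app (bracket V X) Y x - g.app X (bracket V Y) x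

/-- `V` is a Killing vector field: `L_V g = 0`. -/
def IsKilling (V : VField m M) : Prop :=
  ∀ X Y : VField m M, SmoothField X → SmoothField Y → ∀ x, g.lieDeriv V X Y x = 0

end PseudoMetric

end Geometry

/-- A field of endomorphisms applied to a vector field. -/
def applyEnd {m : ℕ} {M : Type*} [TopologicalSpace M] [ChartedSpace (EuclideanSpace ℝ (Fin m)) M]
    (φ : (x : M) → TangentSpace (𝓡 m) x →L[ℝ] TangentSpace (𝓡 m) x) (X : VField m M) :
    VField m M :=
  fun x ↦ φ x (X x)

/-- An almost paracontact metric structure `(φ, ξ, η, g)` on a manifold of dimension `2n+1`. -/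
structure AlmostParacontactMetric (n : ℕ) (M : Type*) [TopologicalSpace M]
    [ChartedSpace (EuclideanSpace ℝ (Fin (2 * n + 1))) M]
    [IsManifold (𝓡 (2 * n + 1)) ∞ M] where
  /-- the (1,1)-tensor field -/
  φ : (x : M) → TangentSpace (𝓡 (2 * n + 1)) x →L[ℝ] TangentSpace (𝓡 (2 * n + 1)) x
  /-- the characteristic (Reeb) vector field -/
  ξ : VField (2 * n + 1) M
  /-- the 1-form -/
  η : (x : M) → TangentSpace (𝓡 (2 * n + 1)) x →L[ℝ] ℝ
  /-- the compatible metric -/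
  g : PseudoMetric (2 * n + 1) M
  φ_contMDiff : ContMDiff (𝓡 (2 * n + 1)) ((𝓡 (2 * n + 1)).prod
      𝓘(ℝ, EuclideanSpace ℝ (Fin (2 * n + 1)) →L[ℝ] EuclideanSpace ℝ (Fin (2 * n + 1)))) ∞
    (fun x ↦ Bundle.TotalSpace.mk'
      (EuclideanSpace ℝ (Fin (2 * n + 1)) →L[ℝ] EuclideanSpace ℝ (Fin (2 * n + 1)))
      (E := fun x ↦ TangentSpace (𝓡 (2 * n + 1)) x →L[ℝ] TangentSpace (𝓡 (2 * n + 1)) x) x (φ x))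
  ξ_smooth : SmoothField ξ
  η_contMDiff : ContMDiff (𝓡 (2 * n + 1)) ((𝓡 (2 * n + 1)).prod
      𝓘(ℝ, EuclideanSpace ℝ (Fin (2 * n + 1)) →L[ℝ] ℝ)) ∞
    (fun x ↦ Bundle.TotalSpace.mk' (EuclideanSpace ℝ (Fin (2 * n + 1)) →L[ℝ] ℝ)
      (E := fun x ↦ TangentSpace (𝓡 (2 * n + 1)) x →L[ℝ] ℝ) x (η x))
  φ_sq : ∀ x v, φ x (φ x v) = v - η x v • ξ x
  η_ξ : ∀ x, η x (ξ x) = 1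
  finrank_pos : ∀ x, Module.finrank ℝ
    ↥(LinearMap.ker (η x).toLinearMap ⊓ Module.End.eigenspace (φ x).toLinearMap 1) = n
  finrank_neg : ∀ x, Module.finrank ℝ
    ↥(LinearMap.ker (η x).toLinearMap ⊓ Module.End.eigenspace (φ x).toLinearMap (-1)) = n
  compatible : ∀ x u v, g.val x (φ x u) (φ x v) = -g.val x u v + η x u * η x v

namespace AlmostParacontactMetric

variable {n : ℕ} {M : Type*} [TopologicalSpace M]
  [ChartedSpace (EuclideanSpace ℝ (Fin (2 * n + 1))) M] [IsManifold (𝓡 (2 * n + 1)) ∞ M]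
  (P : AlmostParacontactMetric n M)

/-- The structure is para-Sasakian: `(∇_X φ) Y = -g(X, Y) ξ + η(Y) X`, where
`(∇_X φ) Y = ∇_X (φ Y) - φ (∇_X Y)`. -/
def IsParaSasakian : Prop :=
  ∀ X Y : VField (2 * n + 1) M, SmoothField X → SmoothField Y → ∀ x,
    P.g.nabla X (applyEnd P.φ Y) x - P.φ x (P.g.nabla X Y x)
      = -P.g.val x (X x) (Y x) • P.ξ x + P.η x (Y x) • X x

/-- The metric is a conformal `η`-Ricci soliton with potential vector field `V`:
`L_V g + 2 S + [2λ - (p + 2/(2n+1))] g + 2μ η ⊗ η = 0`, with real constants `p`, `lam`, `μ`. -/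
def IsConformalEtaRicciSoliton (V : VField (2 * n + 1) M) (p lam μ : ℝ) : Prop :=
  SmoothField V ∧
  ∀ X Y : VField (2 * n + 1) M, SmoothField X → SmoothField Y → ∀ x,
    P.g.lieDeriv V X Y x + 2 * P.g.ricci x (X x) (Y x)
      + (2 * lam - (p + 2 / (2 * (n : ℝ) + 1))) * P.g.val x (X x) (Y x)
      + 2 * μ * (P.η x (X x) * P.η x (Y x)) = 0

/-- The Ricci tensor is `S = a g + b η ⊗ η`. -/
def RicciEq (a b : M → ℝ) : Prop :=
  ∀ x u v, P.g.ricci x u v = a x * P.g.val x u v + b x * (P.η x u * P.η x v)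

/-- The manifold is `η`-Einstein: `S = a g + b η ⊗ η` for some smooth functions `a`, `b`. -/
def IsEtaEinstein : Prop :=
  ∃ a b : M → ℝ, ContMDiff (𝓡 (2 * n + 1)) 𝓘(ℝ, ℝ) ∞ a ∧
    ContMDiff (𝓡 (2 * n + 1)) 𝓘(ℝ, ℝ) ∞ b ∧ P.RicciEq a b

/-- `V` leaves `φ` invariant: `L_V φ = 0`, where `(L_V φ) X = [V, φ X] - φ [V, X]`. -/
def LeavesPhiInvariant (V : VField (2 * n + 1) M) : Prop :=
  ∀ X : VField (2 * n + 1) M, SmoothField X → ∀ x,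
    bracket V (applyEnd P.φ X) x - P.φ x (bracket V X x) = 0

end AlmostParacontactMetric

end ParaSasaki

end

noncomputable section

namespace ParaSasaki

/-! Write `Λ = 2λ - (p + 2/(2n+1))`, `h = L_V g` and `Γ = L_V ∇`. Since `S(X, ξ) = -2n η(X)`, the
soliton equation gives `h(X, ξ) = 2τ η(X)` with the constant `τ = (4n - Λ - 2μ)/2`. In a
para-Sasakian structure `∇ξ = -φ`, so `ξ` is Killing; the Ricci operator commutes with `φ`
(`ricci_φ`), and so `S` is parallel along `ξ` (`nabla_ξ_ricci`). Therefore `∇_ξ h = 0`, and the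
Koszul-type formula `two_mul_g_lieNabla` determines `Γ(X, ξ)`.

Computing `(L_V R)(X, ξ)ξ` once from `R(X, ξ)ξ = η(X)ξ - X` and once from `∇Γ` forces `h = τ(g +
η⊗η)` (`lieMetric_eq_mul`). Substituted in the soliton equation, this is the `η`-Einstein property.
Now `Γ` is known completely, and contracting `L_V R` gives `L_V S = 2τ(g - (2n+1) η⊗η)`
(`lie_ricci_eq`). Comparison with the Lie derivative of the `η`-Einstein formula yields `τ(Λ + τ +
4) = 0`. The factor `τ` vanishes exactly under equality (1), and then `h = 0`. The other factor
vanishes exactly under equality (2); the comparison then also gives `[V, ξ] = -τξ`, and `Γ(X, ξ) =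
-τφX` turns into `L_V φ = 0`.

These arguments use only formal rules: a Lie ring of fields acting by derivations, the Koszul
formula, and a trace compatible with adjoints and Lie derivatives. They are carried out over an
abstract commutative ring `A`. The manifold enters through the proof that smooth functions and
fields obey the rules: bump functions make tensorial maps pointwise, localized frames give the
trace, and Cramer's rule gives smoothness of `∇`. -/

/-- An algebraic model of pseudo-Riemannian calculus: `A` plays the role of the smooth functions,
`𝔛` of the smooth vector fields, `D X f` is the derivative of `f` along `X`, `nabla` is determined
by the Koszul formula and `tr` is the trace of fields of endomorphisms. -/
structure LeviCivitaCalculus (A 𝔛 : Type*) [CommRing A] [Algebra ℝ A] [LieRing 𝔛]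
    [Module A 𝔛] where
  D : 𝔛 →ₗ[A] Derivation ℝ A A
  lie_smul : ∀ (X : 𝔛) (f : A) (Y : 𝔛), ⁅X, f • Y⁆ = D X f • Y + f • ⁅X, Y⁆
  D_lie : ∀ (X Y : 𝔛) (f : A), D ⁅X, Y⁆ f = D X (D Y f) - D Y (D X f)
  g : 𝔛 →ₗ[A] 𝔛 →ₗ[A] A
  g_comm : ∀ X Y, g X Y = g Y X
  g_nondeg : ∀ X, (∀ Y, g X Y = 0) → X = 0
  nabla : 𝔛 → 𝔛 → 𝔛
  koszul : ∀ X Y Z, 2 * g (nabla X Y) Z = D X (g Y Z) + D Y (g X Z) - D Z (g X Y)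
    + g ⁅X, Y⁆ Z - g ⁅X, Z⁆ Y - g ⁅Y, Z⁆ X
  tr : (𝔛 →ₗ[A] 𝔛) →ₗ[A] A
  tr_comp_comm : ∀ S T : 𝔛 →ₗ[A] 𝔛, tr (S ∘ₗ T) = tr (T ∘ₗ S)
  tr_smulRight : ∀ (α : 𝔛 →ₗ[A] A) (W : 𝔛), tr (α.smulRight W) = α W
  tr_adjoint : ∀ S T : 𝔛 →ₗ[A] 𝔛, (∀ X Y, g (S X) Y = g X (T Y)) → tr S = tr T
  D_tr : ∀ (V : 𝔛) (S T : 𝔛 →ₗ[A] 𝔛), (∀ X, T X = ⁅V, S X⁆ - S ⁅V, X⁆) → D V (tr S) = tr T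

/-! ### The Levi-Civita connection from the Koszul formula. -/

namespace LeviCivitaCalculus

variable {A 𝔛 : Type*} [CommRing A] [Algebra ℝ A] [LieRing 𝔛] [Module A 𝔛]

theorem eq_of_two_mul_eq {A : Type*} [CommRing A] [Algebra ℝ A] {a b : A} (h : 2 * a = 2 * b) :
    a = b := by
  have h2 : IsUnit (2 : A) := by
    have := (IsUnit.mk0 (2 : ℝ) two_ne_zero).map (algebraMap ℝ A)
    rwa [map_ofNat] at this
  exact h2.mul_left_cancel h

variable (C : LeviCivitaCalculus A 𝔛)

theorem ext_g {X Y : 𝔛} (h : ∀ Z, C.g X Z = C.g Y Z) : X = Y :=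
  sub_eq_zero.1 (C.g_nondeg _ fun Z ↦ by simp [h Z])

theorem smul_lie (f : A) (X Y : 𝔛) : ⁅f • X, Y⁆ = f • ⁅X, Y⁆ - C.D Y f • X := by
  rw [← lie_skew, C.lie_smul, ← lie_skew Y X]
  module

theorem D_mul (X : 𝔛) (a b : A) : C.D X (a * b) = a * C.D X b + C.D X a * b := by
  simp [mul_comm]

theorem nabla_add_left (X X' Y : 𝔛) : C.nabla (X + X') Y = C.nabla X Y + C.nabla X' Y := by
  refine C.ext_g fun Z ↦ eq_of_two_mul_eq ?_
  have h := C.koszul (X + X') Y Z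
  simp only [map_add, add_lie, LinearMap.add_apply, Derivation.add_apply] at h ⊢
  linear_combination h - C.koszul X Y Z - C.koszul X' Y Z

theorem nabla_add_right (X Y Y' : 𝔛) : C.nabla X (Y + Y') = C.nabla X Y + C.nabla X Y' := by
  refine C.ext_g fun Z ↦ eq_of_two_mul_eq ?_
  have h := C.koszul X (Y + Y') Z
  simp only [map_add, add_lie, lie_add, LinearMap.add_apply, Derivation.add_apply] at h ⊢
  linear_combination h - C.koszul X Y Z - C.koszul X Y' Z

theorem nabla_smul_left (f : A) (X Y : 𝔛) : C.nabla (f • X) Y = f • C.nabla X Y := by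
  refine C.ext_g fun Z ↦ eq_of_two_mul_eq ?_
  have h := C.koszul (f • X) Y Z
  simp only [map_smul, C.smul_lie, map_sub, LinearMap.smul_apply,
    LinearMap.sub_apply, Derivation.smul_apply, smul_eq_mul, C.D_mul] at h ⊢
  linear_combination h - f * C.koszul X Y Z

theorem nabla_smul_right (f : A) (X Y : 𝔛) :
    C.nabla X (f • Y) = C.D X f • Y + f • C.nabla X Y := by
  refine C.ext_g fun Z ↦ eq_of_two_mul_eq ?_
  have h := C.koszul X (f • Y) Z
  simp only [map_smul, C.smul_lie, C.lie_smul, map_add, map_sub, LinearMap.smul_apply,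
    LinearMap.add_apply, LinearMap.sub_apply, Derivation.smul_apply, smul_eq_mul, C.D_mul] at h ⊢
  linear_combination h - f * C.koszul X Y Z - C.D Z f * C.g_comm X Y

theorem nabla_zero_right (X : 𝔛) : C.nabla X 0 = 0 := by
  simpa using C.nabla_smul_right 0 X 0

theorem nabla_neg_left (X Y : 𝔛) : C.nabla (-X) Y = -C.nabla X Y := by
  simpa using C.nabla_smul_left (-1) X Y

theorem nabla_neg_right (X Y : 𝔛) : C.nabla X (-Y) = -C.nabla X Y := by
  simpa using C.nabla_smul_right (-1) X Y

theorem nabla_sub_left (X X' Y : 𝔛) : C.nabla (X - X') Y = C.nabla X Y - C.nabla X' Y := by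
  rw [sub_eq_add_neg, nabla_add_left, nabla_neg_left, sub_eq_add_neg]

theorem nabla_sub_right (X Y Y' : 𝔛) : C.nabla X (Y - Y') = C.nabla X Y - C.nabla X Y' := by
  rw [sub_eq_add_neg, nabla_add_right, nabla_neg_right, sub_eq_add_neg]

theorem lie_eq (X Y : 𝔛) : ⁅X, Y⁆ = C.nabla X Y - C.nabla Y X := by
  refine C.ext_g fun Z ↦ eq_of_two_mul_eq ?_
  have h : C.g ⁅Y, X⁆ Z = -C.g ⁅X, Y⁆ Z := by
    rw [← lie_skew X Y, map_neg, LinearMap.neg_apply, neg_neg]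
  simp only [map_sub, LinearMap.sub_apply]
  linear_combination C.koszul Y X Z - C.koszul X Y Z + h + congrArg (C.D Z) (C.g_comm X Y)

theorem D_g (X Y Z : 𝔛) : C.D X (C.g Y Z) = C.g (C.nabla X Y) Z + C.g Y (C.nabla X Z) := by
  apply eq_of_two_mul_eq
  have h : C.g ⁅Z, Y⁆ X = -C.g ⁅Y, Z⁆ X := by
    rw [← lie_skew Y Z, map_neg, LinearMap.neg_apply, neg_neg]
  rw [C.g_comm Y (C.nabla X Z)]
  linear_combination -C.koszul X Y Z - C.koszul X Z Y + h - congrArg (C.D X) (C.g_comm Z Y)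

/-! ### Symmetries of the curvature and Ricci tensors. -/

/-- The curvature `R(X, Y) Z`. -/
def curv (X Y Z : 𝔛) : 𝔛 :=
  C.nabla X (C.nabla Y Z) - C.nabla Y (C.nabla X Z) - C.nabla ⁅X, Y⁆ Z

theorem curv_swap (X Y Z : 𝔛) : C.curv Y X Z = -C.curv X Y Z := by
  rw [curv, curv, ← lie_skew, nabla_neg_left]
  abel

theorem curv_add_left (X X' Y Z : 𝔛) : C.curv (X + X') Y Z = C.curv X Y Z + C.curv X' Y Z := by
  simp only [curv, nabla_add_left, nabla_add_right, add_lie]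
  abel

theorem curv_smul_left (f : A) (X Y Z : 𝔛) : C.curv (f • X) Y Z = f • C.curv X Y Z := by
  simp only [curv, nabla_smul_left, nabla_smul_right, C.smul_lie, nabla_sub_left]
  module

theorem curv_add_mid (X Y Y' Z : 𝔛) : C.curv X (Y + Y') Z = C.curv X Y Z + C.curv X Y' Z := by
  simp only [curv, nabla_add_left, nabla_add_right, lie_add]
  abel

theorem curv_smul_mid (f : A) (X Y Z : 𝔛) : C.curv X (f • Y) Z = f • C.curv X Y Z := by
  rw [← neg_inj, ← curv_swap, curv_smul_left, curv_swap, smul_neg]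

theorem curv_add_right (X Y Z Z' : 𝔛) : C.curv X Y (Z + Z') = C.curv X Y Z + C.curv X Y Z' := by
  simp only [curv, nabla_add_right]
  abel

theorem curv_smul_right (f : A) (X Y Z : 𝔛) : C.curv X Y (f • Z) = f • C.curv X Y Z := by
  simp only [curv, nabla_smul_right, nabla_add_right, C.D_lie]
  module

theorem curv_cyclic (X Y Z : 𝔛) : C.curv X Y Z + C.curv Y Z X + C.curv Z X Y = 0 := by
  have h1 := C.lie_eq X ⁅Y, Z⁆
  have h2 := C.lie_eq Y ⁅Z, X⁆
  have h3 := C.lie_eq Z ⁅X, Y⁆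
  have h4 := lie_jacobi X Y Z
  rw [h1, h2, h3] at h4
  rw [C.lie_eq Y Z, C.lie_eq Z X, C.lie_eq X Y] at h4
  simp only [curv, C.lie_eq Y Z, C.lie_eq Z X, C.lie_eq X Y]
  simp only [nabla_sub_right, nabla_sub_left] at h4 ⊢
  rw [← h4]
  abel

theorem g_curv_skew (X Y Z W : 𝔛) : C.g (C.curv X Y Z) W = -C.g (C.curv X Y W) Z := by
  have h := C.D_lie X Y (C.g Z W)
  simp only [C.D_g, map_add] at h
  simp only [curv, map_sub, LinearMap.sub_apply]
  rw [C.g_comm (C.nabla X (C.nabla Y W)) Z, C.g_comm (C.nabla Y (C.nabla X W)) Z,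
    C.g_comm (C.nabla ⁅X, Y⁆ W) Z]
  linear_combination -h

/-- The octahedron argument: a signed sum of four cyclic identities, in which skewness in each pair
cancels all but twice the wanted terms. -/
theorem g_curv_pair (X Y Z W : 𝔛) : C.g (C.curv X Y Z) W = C.g (C.curv Z W X) Y := by
  have hc (X Y Z W : 𝔛) :
      C.g (C.curv X Y Z) W + C.g (C.curv Y Z X) W + C.g (C.curv Z X Y) W = 0 := by
    have := congrArg (fun U ↦ C.g U W) (C.curv_cyclic X Y Z)
    simpa using this
  have hs (X Y Z W : 𝔛) : C.g (C.curv Y X Z) W = -C.g (C.curv X Y Z) W := by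
    rw [C.curv_swap]; simp
  have k := C.g_curv_skew
  apply eq_of_two_mul_eq
  linear_combination hc X Y Z W + hc Y Z W X - hc Z W X Y - hc W X Y Z + k X Y Z W - k Z W X Y
    - k Y Z X W - k Z X Y W + hs Z X W Y + k W X Y Z + k Y W X Z - hs Y W Z X

/-- The curvature endomorphism `X ↦ R(X, Y) Z`. -/
def curvEnd (Y Z : 𝔛) : 𝔛 →ₗ[A] 𝔛 where
  toFun X := C.curv X Y Z
  map_add' X X' := C.curv_add_left X X' Y Z
  map_smul' f X := C.curv_smul_left f X Y Z

@[simp]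
theorem curvEnd_apply (X Y Z : 𝔛) : C.curvEnd Y Z X = C.curv X Y Z := rfl

/-- The Ricci tensor. -/
def ric (Y Z : 𝔛) : A := C.tr (C.curvEnd Y Z)

/-- Pair symmetry in the form of adjointness; since adjoint endomorphisms have equal trace, it makes
the Ricci tensor symmetric. -/
theorem curvEnd_adjoint (Y Z X W : 𝔛) : C.g (C.curvEnd Y Z X) W = C.g X (C.curvEnd Z Y W) := by
  rw [curvEnd_apply, curvEnd_apply, C.g_curv_pair, C.curv_swap, C.g_comm X]
  rw [map_neg, LinearMap.neg_apply, ← C.g_curv_skew]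

theorem ric_comm (Y Z : 𝔛) : C.ric Y Z = C.ric Z Y :=
  C.tr_adjoint _ _ (C.curvEnd_adjoint Y Z)

theorem ric_add_left (Y Y' Z : 𝔛) : C.ric (Y + Y') Z = C.ric Y Z + C.ric Y' Z := by
  rw [ric, ric, ric, ← map_add]
  congr 1
  ext X
  simp [curv_add_mid]

theorem ric_smul_left (f : A) (Y Z : 𝔛) : C.ric (f • Y) Z = f * C.ric Y Z := by
  rw [ric, ric, ← smul_eq_mul, ← map_smul]
  congr 1
  ext X
  simp [curv_smul_mid]

/-- The Ricci tensor as a bilinear map. -/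
def ricci : 𝔛 →ₗ[A] 𝔛 →ₗ[A] A :=
  LinearMap.mk₂ A C.ric C.ric_add_left C.ric_smul_left
    (fun Y Z Z' ↦ by rw [ric_comm, ric_add_left, ric_comm, C.ric_comm Z'])
    (fun f Y Z ↦ by rw [ric_comm, ric_smul_left, ric_comm, smul_eq_mul])

theorem ricci_apply (Y Z : 𝔛) : C.ricci Y Z = C.tr (C.curvEnd Y Z) := rfl

theorem ricci_comm (Y Z : 𝔛) : C.ricci Y Z = C.ricci Z Y := C.ric_comm Y Z

/-! ### Lie derivatives of the metric, the connection and the curvature. -/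

/-- The Lie derivative of the metric. -/
def lieMetric (V X Y : 𝔛) : A := C.D V (C.g X Y) - C.g ⁅V, X⁆ Y - C.g X ⁅V, Y⁆

/-- The Lie derivative of the connection,
`Γ(X, Y) = [V, ∇_X Y] - ∇_[V,X] Y - ∇_X [V, Y]`. -/
def lieNabla (V X Y : 𝔛) : 𝔛 := ⁅V, C.nabla X Y⁆ - C.nabla ⁅V, X⁆ Y - C.nabla X ⁅V, Y⁆

/-- The connection has no torsion, so the difference of the two sides is the Jacobi identity. -/
theorem lieNabla_comm (V X Y : 𝔛) : C.lieNabla V X Y = C.lieNabla V Y X := by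
  have h : ⁅V, ⁅X, Y⁆⁆ = ⁅⁅V, X⁆, Y⁆ + ⁅X, ⁅V, Y⁆⁆ := leibniz_lie V X Y
  rw [C.lie_eq X Y, C.lie_eq ⁅V, X⁆ Y, C.lie_eq X ⁅V, Y⁆, lie_sub] at h
  rw [← sub_eq_zero] at h ⊢
  rw [← h, lieNabla, lieNabla]
  abel

theorem lieNabla_add_left (V X X' Y : 𝔛) :
    C.lieNabla V (X + X') Y = C.lieNabla V X Y + C.lieNabla V X' Y := by
  simp only [lieNabla, nabla_add_left, lie_add]
  abel

theorem lieNabla_neg_left (V X Y : 𝔛) : C.lieNabla V (-X) Y = -C.lieNabla V X Y := by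
  simp only [lieNabla, nabla_neg_left, lie_neg]
  abel

theorem lieNabla_sub_left (V X X' Y : 𝔛) :
    C.lieNabla V (X - X') Y = C.lieNabla V X Y - C.lieNabla V X' Y := by
  rw [sub_eq_add_neg, lieNabla_add_left, lieNabla_neg_left, sub_eq_add_neg]

theorem lieNabla_zero_left (V Y : 𝔛) : C.lieNabla V 0 Y = 0 := by
  simpa using C.lieNabla_sub_left V 0 0 Y

/-- The covariant derivative of the Lie derivative of the metric. -/
theorem nabla_lieMetric (V X Y Z : 𝔛) :
    C.D X (C.lieMetric V Y Z) - C.lieMetric V (C.nabla X Y) Z - C.lieMetric V Y (C.nabla X Z) =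
      C.g (C.lieNabla V X Y) Z + C.g Y (C.lieNabla V X Z) := by
  have h := C.D_lie V X (C.g Y Z)
  simp only [C.D_g, map_add] at h
  simp only [lieMetric, lieNabla, map_sub, LinearMap.sub_apply, C.D_g, map_add]
  linear_combination h

/-- The Koszul trick: `nabla_lieMetric` for the three cyclic choices is solved for `lieNabla` by
means of its symmetry. -/
theorem two_mul_g_lieNabla (V X Y Z : 𝔛) :
    2 * C.g (C.lieNabla V X Y) Z =
      (C.D X (C.lieMetric V Y Z) - C.lieMetric V (C.nabla X Y) Z - C.lieMetric V Y (C.nabla X Z))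
      + (C.D Y (C.lieMetric V X Z) - C.lieMetric V (C.nabla Y X) Z - C.lieMetric V X (C.nabla Y Z))
      - (C.D Z (C.lieMetric V X Y) - C.lieMetric V (C.nabla Z X) Y
        - C.lieMetric V X (C.nabla Z Y)) := by
  rw [nabla_lieMetric, nabla_lieMetric, nabla_lieMetric, C.lieNabla_comm V Y X,
    C.lieNabla_comm V Z X, C.lieNabla_comm V Z Y, C.g_comm Y (C.lieNabla V X Z)]
  ring

/-- The covariant derivative of `lieNabla V`. -/
def nablaLieNabla (V X Y Z : 𝔛) : 𝔛 :=
  C.nabla X (C.lieNabla V Y Z) - C.lieNabla V (C.nabla X Y) Z - C.lieNabla V Y (C.nabla X Z)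

/-- The Lie derivative of the curvature in terms of that of the connection. -/
theorem lie_curv (V X Y Z : 𝔛) :
    ⁅V, C.curv X Y Z⁆ - C.curv ⁅V, X⁆ Y Z - C.curv X ⁅V, Y⁆ Z - C.curv X Y ⁅V, Z⁆ =
      C.nablaLieNabla V X Y Z - C.nablaLieNabla V Y X Z := by
  have h : C.lieNabla V (C.nabla X Y) Z - C.lieNabla V (C.nabla Y X) Z
      = C.lieNabla V ⁅X, Y⁆ Z := by
    rw [← lieNabla_sub_left, ← C.lie_eq]
  have e : C.nablaLieNabla V X Y Z - C.nablaLieNabla V Y X Z =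
      C.nabla X (C.lieNabla V Y Z) - C.nabla Y (C.lieNabla V X Z) - C.lieNabla V ⁅X, Y⁆ Z
      - C.lieNabla V Y (C.nabla X Z) + C.lieNabla V X (C.nabla Y Z) := by
    rw [← h, nablaLieNabla, nablaLieNabla]
    abel
  rw [e]
  simp only [lieNabla, curv, nabla_sub_right, lie_sub, leibniz_lie V X Y, nabla_add_left]
  abel

/-- The Lie derivative of the Ricci tensor is the trace of that of the curvature. -/
theorem lie_ricci (V Y Z : 𝔛) (T : 𝔛 →ₗ[A] 𝔛)
    (hT : ∀ X, T X = C.nablaLieNabla V X Y Z - C.nablaLieNabla V Y X Z) :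
    C.D V (C.ricci Y Z) = C.ricci ⁅V, Y⁆ Z + C.ricci Y ⁅V, Z⁆ + C.tr T := by
  rw [ricci_apply, ricci_apply, ricci_apply, ← map_add, ← map_add]
  refine C.D_tr V _ _ fun X ↦ ?_
  simp only [LinearMap.add_apply, hT, ← C.lie_curv, curvEnd_apply]
  abel

end LeviCivitaCalculus
-- Para-Sasakian identities.
/-- A para-Sasakian structure on an algebraic model of pseudo-Riemannian calculus. -/
structure ParaSasakianCalculus (A 𝔛 : Type*) [CommRing A] [Algebra ℝ A] [LieRing 𝔛]
    [Module A 𝔛] (n : ℕ) extends LeviCivitaCalculus A 𝔛 where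
  φ : 𝔛 →ₗ[A] 𝔛
  ξ : 𝔛
  η : 𝔛 →ₗ[A] A
  φ_sq : ∀ X, φ (φ X) = X - η X • ξ
  φ_ξ : φ ξ = 0
  η_ξ : η ξ = 1
  g_ξ : ∀ X, g X ξ = η X
  g_φ : ∀ X Y, g (φ X) Y = -g X (φ Y)
  nabla_φ : ∀ X Y, nabla X (φ Y) = φ (nabla X Y) - g X Y • ξ + η Y • X
  tr_id : tr LinearMap.id = 2 * n + 1

namespace ParaSasakianCalculus

open LeviCivitaCalculus

variable {A 𝔛 : Type*} [CommRing A] [Algebra ℝ A] [LieRing 𝔛] [Module A 𝔛] {n : ℕ}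
  (C : ParaSasakianCalculus A 𝔛 n)

theorem g_ξ_left (X : 𝔛) : C.g C.ξ X = C.η X := by rw [C.g_comm, C.g_ξ]

theorem η_φ (X : 𝔛) : C.η (C.φ X) = 0 := by
  rw [← C.g_ξ, C.g_φ, C.φ_ξ, map_zero, neg_zero]

theorem g_φ_φ (X Y : 𝔛) : C.g (C.φ X) (C.φ Y) = -C.g X Y + C.η X * C.η Y := by
  rw [C.g_φ, C.φ_sq, map_sub, map_smul, C.g_ξ, smul_eq_mul]
  ring

/-- Differentiating `g(ξ, ξ) = 1` makes `∇_X ξ` orthogonal to `ξ`. Differentiating `φξ = 0` gives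
`φ(∇_X ξ) = η(X)ξ - X`, from which a second `φ` recovers `∇_X ξ`. -/
theorem nabla_ξ (X : 𝔛) : C.nabla X C.ξ = -C.φ X := by
  have h0 : C.η (C.nabla X C.ξ) = 0 := by
    have h := C.D_g X C.ξ C.ξ
    rw [C.g_ξ, C.η_ξ, C.g_ξ, C.g_ξ_left, Derivation.map_one_eq_zero] at h
    apply eq_of_two_mul_eq
    linear_combination -h
  have h1 := C.nabla_φ X C.ξ
  rw [C.φ_ξ, C.nabla_zero_right, C.g_ξ, C.η_ξ, one_smul] at h1
  have h2 : C.φ (C.nabla X C.ξ) = C.η X • C.ξ - X :=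
    sub_eq_zero.1 (Eq.trans (by abel) h1.symm)
  have h3 := C.φ_sq (C.nabla X C.ξ)
  rw [h2, h0, zero_smul, sub_zero, map_sub, map_smul, C.φ_ξ, smul_zero, zero_sub] at h3
  exact h3.symm

theorem D_η (X Y : 𝔛) : C.D X (C.η Y) = C.η (C.nabla X Y) - C.g (C.φ X) Y := by
  rw [← C.g_ξ, C.D_g, C.g_ξ, C.nabla_ξ, C.g_comm Y, map_neg, LinearMap.neg_apply, sub_eq_add_neg]

/-- As `∇ξ = -φ`, the left side is `(∇_Y φ)X - (∇_X φ)Y`. -/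
theorem curv_ξ (X Y : 𝔛) : C.curv X Y C.ξ = C.η X • Y - C.η Y • X := by
  have h := congrArg C.φ (C.lie_eq X Y)
  rw [map_sub] at h
  rw [curv, C.nabla_ξ, C.nabla_ξ, C.nabla_ξ, C.nabla_neg_right, C.nabla_neg_right, C.nabla_φ,
    C.nabla_φ, C.g_comm Y X, h]
  module

theorem curv_ξ_mid (X Y : 𝔛) : C.curv X C.ξ Y = C.g X Y • C.ξ - C.η Y • X := by
  refine C.ext_g fun Z ↦ ?_
  rw [C.g_curv_pair, C.g_curv_skew, C.curv_ξ]
  simp only [map_sub, map_smul, LinearMap.sub_apply, LinearMap.smul_apply, smul_eq_mul, C.g_ξ_left]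
  rw [C.g_comm Z X, C.g_comm Y X]
  ring

theorem ricci_ξ (Y : 𝔛) : C.ricci Y C.ξ = -(2 * n) * C.η Y := by
  have h : C.curvEnd Y C.ξ = C.η.smulRight Y - C.η Y • LinearMap.id := by
    ext X
    simp [C.curv_ξ]
  rw [C.ricci_apply, h, map_sub, map_smul, C.tr_smulRight, C.tr_id, smul_eq_mul]
  ring

/-- The commutator of the curvature with `φ`. -/
theorem curv_φ (X Y Z : 𝔛) :
    C.curv X Y (C.φ Z) = C.φ (C.curv X Y Z) + C.g Y Z • C.φ X - C.g X Z • C.φ Y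
      - C.g (C.φ X) Z • Y + C.g (C.φ Y) Z • X := by
  have h := C.lie_eq X Y
  simp only [curv, C.nabla_φ, C.nabla_add_right, C.nabla_sub_right, C.nabla_smul_right, C.D_g,
    C.D_η, C.nabla_ξ, h, map_sub, LinearMap.sub_apply]
  module

/-- By skewness, `-φ` is the adjoint of `φ`, so the trace equals its own negative. -/
theorem tr_φ : C.tr C.φ = 0 := by
  have h := C.tr_adjoint C.φ (-C.φ) fun X Y ↦ by rw [C.g_φ]; simp
  rw [map_neg] at h
  apply eq_of_two_mul_eq
  linear_combination h

/-- The Ricci operator commutes with `φ`. -/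
theorem ricci_φ (Y Z : 𝔛) : C.ricci (C.φ Y) Z = -C.ricci Y (C.φ Z) := by
  -- The adjoint of `φ ∘ R(·, Y)Z` is `-R(·, Z)Y ∘ φ`.
  have hskew (Y Z : 𝔛) : C.tr (C.φ ∘ₗ C.curvEnd Y Z) = -C.tr (C.φ ∘ₗ C.curvEnd Z Y) := by
    rw [C.tr_comp_comm C.φ (C.curvEnd Z Y), ← map_neg]
    refine C.tr_adjoint _ _ fun X W ↦ ?_
    simp only [LinearMap.comp_apply, LinearMap.neg_apply]
    rw [C.g_φ, C.curvEnd_adjoint, map_neg]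
  -- Contraction of `curv_φ`: the identity term contributes `2n + 1` and two rank-one terms
  -- contribute `-1` each. Both summands on the right are skew in `Y` and `Z`, which gives the
  -- claim.
  have hric (Y Z : 𝔛) : C.ricci Y (C.φ Z) =
      C.tr (C.φ ∘ₗ C.curvEnd Y Z) + (2 * n - 1) * C.g (C.φ Y) Z := by
    have h : C.curvEnd Y (C.φ Z) = C.φ ∘ₗ C.curvEnd Y Z + C.g Y Z • C.φ
        - (C.g Z).smulRight (C.φ Y) + (C.g (C.φ Z)).smulRight Y
        + C.g (C.φ Y) Z • LinearMap.id := by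
      ext X
      simp only [curvEnd_apply, C.curv_φ, LinearMap.add_apply, LinearMap.sub_apply,
        LinearMap.comp_apply, LinearMap.smul_apply, LinearMap.smulRight_apply, LinearMap.id_apply]
      rw [C.g_φ X Z, C.g_comm X Z, C.g_comm X (C.φ Z)]
      module
    rw [C.ricci_apply, h]
    simp only [map_add, map_sub, map_smul, C.tr_smulRight, C.tr_id, C.tr_φ, smul_eq_mul]
    rw [C.g_φ Z Y, C.g_comm Z (C.φ Y)]
    ring
  rw [C.ricci_comm, hric, hric, hskew, C.g_φ Z Y, C.g_comm Z (C.φ Y)]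
  ring

theorem lieMetric_ξ (X Y : 𝔛) : C.lieMetric C.ξ X Y = 0 := by
  rw [lieMetric, C.D_g, C.lie_eq, C.lie_eq, C.nabla_ξ, C.nabla_ξ]
  simp only [map_sub, map_neg, LinearMap.sub_apply, LinearMap.neg_apply, C.g_φ X Y]
  ring

theorem lieNabla_ξ (X Y : 𝔛) : C.lieNabla C.ξ X Y = 0 := by
  refine C.g_nondeg _ fun Z ↦ eq_of_two_mul_eq ?_
  rw [C.two_mul_g_lieNabla]
  simp only [C.lieMetric_ξ, map_zero]
  ring

/-- A Killing field preserves the Ricci tensor. Along `ξ`, Lie and covariant derivatives differ by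
the action of `φ`, which annihilates the Ricci tensor by `ricci_φ`. -/
theorem nabla_ξ_ricci (Y Z : 𝔛) :
    C.D C.ξ (C.ricci Y Z) = C.ricci (C.nabla C.ξ Y) Z + C.ricci Y (C.nabla C.ξ Z) := by
  rw [C.lie_ricci C.ξ Y Z 0 fun X ↦ by
    simp only [nablaLieNabla, C.lieNabla_ξ, C.nabla_zero_right, LinearMap.zero_apply, sub_self]]
  rw [C.lie_eq, C.lie_eq, C.nabla_ξ, C.nabla_ξ]
  simp only [map_sub, map_neg, LinearMap.sub_apply, LinearMap.neg_apply, map_zero, C.ricci_φ]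
  ring

/-! ### Solitons: the algebraic core of the theorem. -/

/-- The field `V` is the potential of an `η`-Ricci soliton with constants `Λ`, `μ`; the constant
`τ` is half of the value of `L_V g` on `ξ`. -/
structure IsSoliton (V : 𝔛) (Λ μ τ : A) : Prop where
  D_Λ : ∀ X, C.D X Λ = 0
  D_μ : ∀ X, C.D X μ = 0
  D_τ : ∀ X, C.D X τ = 0
  two_τ : 2 * τ = 4 * n - Λ - 2 * μ
  lieMetric_eq : ∀ X Y,
    C.lieMetric V X Y = -(2 * C.ricci X Y + Λ * C.g X Y + 2 * μ * (C.η X * C.η Y))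

namespace IsSoliton

variable {C} {V : 𝔛} {Λ μ τ : A} (h : C.IsSoliton V Λ μ τ)
include h

theorem lieMetric_ξ_left (X : 𝔛) : C.lieMetric V C.ξ X = 2 * τ * C.η X := by
  rw [h.lieMetric_eq, C.ricci_comm, C.ricci_ξ, C.g_ξ_left, C.η_ξ]
  linear_combination -C.η X * h.two_τ

theorem lieMetric_comm (X Y : 𝔛) : C.lieMetric V X Y = C.lieMetric V Y X := by
  rw [h.lieMetric_eq, h.lieMetric_eq, C.ricci_comm, C.g_comm]
  ring

theorem lieMetric_φ (X Y : 𝔛) : C.lieMetric V (C.φ X) Y = -C.lieMetric V X (C.φ Y) := by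
  rw [h.lieMetric_eq, h.lieMetric_eq, C.ricci_φ, C.g_φ, C.η_φ, C.η_φ]
  ring

theorem lieMetric_φ_φ (X Y : 𝔛) :
    C.lieMetric V (C.φ (C.φ X)) Y = C.lieMetric V X Y - 2 * τ * (C.η X * C.η Y) := by
  rw [mul_left_comm, ← h.lieMetric_ξ_left, h.lieMetric_eq, h.lieMetric_eq, h.lieMetric_eq, C.φ_sq]
  simp only [map_sub, map_smul, LinearMap.sub_apply, LinearMap.smul_apply, smul_eq_mul, C.η_ξ]
  ring

theorem lieMetric_neg_left (X Y : 𝔛) : C.lieMetric V (-X) Y = -C.lieMetric V X Y := by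
  rw [h.lieMetric_eq, h.lieMetric_eq]
  simp only [map_neg, LinearMap.neg_apply]
  ring

/-- By the soliton equation, the Lie derivative of the metric is a constant-coefficient combination
of `S`, `g` and `η ⊗ η`, all parallel along `ξ`. -/
theorem nabla_ξ_lieMetric (X Y : 𝔛) : C.D C.ξ (C.lieMetric V X Y) =
    C.lieMetric V (C.nabla C.ξ X) Y + C.lieMetric V X (C.nabla C.ξ Y) := by
  simp only [h.lieMetric_eq, map_neg, map_add, C.D_mul, h.D_Λ, h.D_μ, C.nabla_ξ_ricci, C.D_g, C.D_η,
    C.φ_ξ, map_zero, LinearMap.zero_apply]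
  have h2 : C.D C.ξ (2 : A) = 0 := by
    simpa using Derivation.map_natCast (C.D C.ξ) 2
  rw [h2]
  ring

theorem D_two_mul_τ (X : 𝔛) : C.D X (2 * τ) = 0 := by
  have h2 : C.D X (2 : A) = 0 := by
    simpa using Derivation.map_natCast (C.D X) 2
  rw [C.D_mul, h.D_τ, h2]
  ring

/-- With `ξ` in the second slot of `two_mul_g_lieNabla`, the derivative along `ξ` drops out. The
other two terms follow from `h(ξ, ·) = 2τη` and `∇ξ = -φ`, and are equal because `h` is skew under
`φ`. -/
theorem g_lieNabla_ξ (X Z : 𝔛) : C.g (C.lieNabla V X C.ξ) Z =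
    C.lieMetric V (C.φ X) Z - 2 * τ * C.g (C.φ X) Z := by
  apply eq_of_two_mul_eq
  rw [C.two_mul_g_lieNabla, h.nabla_ξ_lieMetric, h.lieMetric_comm X C.ξ,
    h.lieMetric_comm _ C.ξ, h.lieMetric_ξ_left, h.lieMetric_ξ_left, h.lieMetric_ξ_left,
    h.lieMetric_ξ_left,
    C.nabla_ξ, C.nabla_ξ, h.lieMetric_neg_left, h.lieMetric_comm X (-C.φ Z), h.lieMetric_neg_left,
    h.lieMetric_comm _ X, C.D_mul X (2 * τ), C.D_mul Z (2 * τ), h.D_two_mul_τ, h.D_two_mul_τ,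
    C.D_η, C.D_η,
    h.lieMetric_φ, C.g_φ Z X, C.g_comm Z (C.φ X)]
  ring

theorem η_lie_ξ : C.η ⁅V, C.ξ⁆ = -τ := by
  have h1 := h.lieMetric_ξ_left C.ξ
  rw [lieMetric, C.g_ξ, C.g_ξ, C.g_ξ_left, C.η_ξ, Derivation.map_one_eq_zero] at h1
  apply eq_of_two_mul_eq
  linear_combination -h1

theorem D_η_sub (X : 𝔛) : C.D V (C.η X) - C.η ⁅V, X⁆ = 2 * τ * C.η X + C.g X ⁅V, C.ξ⁆ := by
  rw [← h.lieMetric_ξ_left, h.lieMetric_comm, lieMetric, C.g_ξ, C.g_ξ]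
  ring

/-- The Lie derivative of the metric of an `η`-Ricci soliton. -/
theorem lieMetric_eq_mul (X Z : 𝔛) :
    C.lieMetric V X Z = τ * (C.g X Z + C.η X * C.η Z) := by
  -- First evaluation of `(L_V R)(X, ξ)ξ`, by the explicit curvature; the unknown `[V, ξ]` cancels
  -- except for its component `η([V, ξ]) = -τ`.
  have hl : ⁅V, C.curv X C.ξ C.ξ⁆ - C.curv ⁅V, X⁆ C.ξ C.ξ - C.curv X ⁅V, C.ξ⁆ C.ξ
      - C.curv X C.ξ ⁅V, C.ξ⁆ = (2 * τ * C.η X) • C.ξ - (2 * τ) • X := by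
    have h1 := h.D_η_sub X
    rw [C.curv_ξ, C.curv_ξ, C.curv_ξ, C.curv_ξ_mid, h.η_lie_ξ, C.η_ξ, lie_sub, C.lie_smul, one_smul,
      one_smul, eq_add_of_sub_eq h1]
    module
  have hξξ : C.lieNabla V C.ξ C.ξ = 0 := C.g_nondeg _ fun W ↦ by
    rw [h.g_lieNabla_ξ, h.lieMetric_φ, h.lieMetric_ξ_left, C.η_φ, C.φ_ξ, map_zero,
      LinearMap.zero_apply]
    ring
  -- Second evaluation, through `Γ`. Since `Γ(ξ, ξ) = 0` and `∇_X ξ = -φX`, the term `(∇_X Γ)(ξ, ξ)`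
  -- is `2Γ(φX, ξ)`.
  have h1 : C.g (C.nablaLieNabla V X C.ξ C.ξ) Z = 2 * (C.lieMetric V X Z - 2 * τ * C.g X Z) := by
    rw [nablaLieNabla, hξξ, C.nabla_zero_right, C.lieNabla_comm V C.ξ, C.nabla_ξ,
      C.lieNabla_neg_left]
    simp only [map_sub, map_neg, map_zero, LinearMap.sub_apply, LinearMap.zero_apply,
      LinearMap.neg_apply, h.g_lieNabla_ξ]
    rw [h.lieMetric_φ_φ, C.φ_sq, map_sub, map_smul, LinearMap.sub_apply, LinearMap.smul_apply,
      C.g_ξ_left, smul_eq_mul]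
    ring
  -- `Γ(·, ξ)` is built from `h`, `g` and `φ`, each parallel along `ξ`.
  have h2 : C.g (C.nablaLieNabla V C.ξ X C.ξ) Z = 0 := by
    have hφ : C.φ (C.nabla C.ξ X) = C.nabla C.ξ (C.φ X) := by
      rw [C.nabla_φ, C.g_ξ_left]
      abel
    have h3 := C.D_g C.ξ (C.lieNabla V X C.ξ) Z
    rw [nablaLieNabla, C.nabla_ξ, C.φ_ξ, neg_zero, C.lieNabla_comm V X 0, C.lieNabla_zero_left,
      sub_zero, map_sub, LinearMap.sub_apply]
    rw [h.g_lieNabla_ξ, h.g_lieNabla_ξ, map_sub, C.D_mul, h.D_two_mul_τ, h.nabla_ξ_lieMetric,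
      C.D_g] at h3
    rw [h.g_lieNabla_ξ, hφ]
    linear_combination -h3
  have h3 := congrArg (fun U ↦ C.g U Z) (C.lie_curv V X C.ξ C.ξ)
  rw [hl] at h3
  simp only [map_sub, map_smul, LinearMap.sub_apply, LinearMap.smul_apply, smul_eq_mul,
    C.g_ξ_left, h1, h2] at h3
  apply eq_of_two_mul_eq
  linear_combination -h3

/-- An `η`-Ricci soliton is `η`-Einstein. -/
theorem two_mul_ricci (X Y : 𝔛) :
    2 * C.ricci X Y = -(Λ + τ) * C.g X Y - (2 * μ + τ) * (C.η X * C.η Y) := by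
  have h1 := h.lieMetric_eq X Y
  rw [h.lieMetric_eq_mul] at h1
  linear_combination h1

theorem lieNabla_eq (X Y : 𝔛) :
    C.lieNabla V X Y = -(τ • (C.η Y • C.φ X + C.η X • C.φ Y)) := by
  refine C.ext_g fun Z ↦ eq_of_two_mul_eq ?_
  rw [C.two_mul_g_lieNabla]
  simp only [h.lieMetric_eq_mul, C.D_mul, h.D_τ, map_add, C.D_g, C.D_η, map_neg, map_smul,
    LinearMap.neg_apply, LinearMap.smul_apply, LinearMap.add_apply, smul_eq_mul]
  rw [C.g_φ Z X, C.g_φ Z Y, C.g_φ Y X, C.g_comm Z (C.φ X), C.g_comm Z (C.φ Y), C.g_comm Y (C.φ X)]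
  ring

theorem nablaLieNabla_eq (X Y Z : 𝔛) : C.nablaLieNabla V X Y Z =
    -(τ • (-C.g (C.φ X) Z • C.φ Y - (C.η Z * C.g X Y) • C.ξ + (2 * C.η Y * C.η Z) • X
      - C.g (C.φ X) Y • C.φ Z - (C.η Y * C.g X Z) • C.ξ)) := by
  simp only [nablaLieNabla, h.lieNabla_eq, C.nabla_neg_right, C.nabla_smul_right, h.D_τ,
    C.nabla_add_right, C.D_η, C.nabla_φ]
  module

/-- The Lie derivative of the Ricci tensor of an `η`-Ricci soliton. -/
theorem lie_ricci_eq (Y Z : 𝔛) : C.D V (C.ricci Y Z) = C.ricci ⁅V, Y⁆ Z + C.ricci Y ⁅V, Z⁆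
    + 2 * τ * (C.g Y Z - (2 * n + 1) * (C.η Y * C.η Z)) := by
  rw [C.lie_ricci V Y Z
    -- The first bracket is `X ↦ (∇_X Γ)(Y, Z)` and the second is `X ↦ -(∇_Y Γ)(X, Z)`, sorted into
    -- rank-one maps and multiples of `id` and `φ`, whose traces are known. The second has trace
    -- zero.
    (-(τ • ((C.g (C.φ Z)).smulRight (C.φ Y) - C.η Z • (C.g Y).smulRight C.ξ
      + (2 * C.η Y * C.η Z) • LinearMap.id + (C.g (C.φ Y)).smulRight (C.φ Z)
      - C.η Y • (C.g Z).smulRight C.ξ)) +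
    τ • (-C.g (C.φ Y) Z • C.φ - C.η Z • (C.g Y).smulRight C.ξ + (2 * C.η Z) • C.η.smulRight Y
      - (C.g (C.φ Y)).smulRight (C.φ Z) - C.g Y Z • C.η.smulRight C.ξ))]
  · simp only [map_add, map_sub, map_neg, map_smul, C.tr_smulRight, C.tr_id, C.tr_φ, smul_eq_mul,
      C.g_φ_φ, C.g_ξ, C.η_ξ, C.g_comm Z Y]
    ring
  · intro X
    simp only [h.nablaLieNabla_eq, LinearMap.add_apply, LinearMap.sub_apply, LinearMap.neg_apply,
      LinearMap.smul_apply, LinearMap.smulRight_apply, LinearMap.id_apply]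
    rw [C.g_φ X Z, C.g_φ X Y, C.g_comm X (C.φ Z), C.g_comm X (C.φ Y), C.g_comm X Y, C.g_comm X Z]
    module

/-- Two expressions for `2 L_V S`: the Lie derivative of the `η`-Einstein formula, and
`lie_ricci_eq`. The field `[V, ξ]` is still unknown and enters through `L_V η`. -/
theorem lie_ricci_combination (Y Z : 𝔛) :
    -(Λ + τ) * (τ * (C.g Y Z + C.η Y * C.η Z)) - (2 * μ + τ) *
      ((2 * τ * C.η Y + C.g Y ⁅V, C.ξ⁆) * C.η Z + C.η Y * (2 * τ * C.η Z + C.g Z ⁅V, C.ξ⁆)) =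
    4 * τ * (C.g Y Z - (2 * n + 1) * (C.η Y * C.η Z)) := by
  have h2 : C.D V (2 : A) = 0 := by
    simpa using Derivation.map_natCast (C.D V) 2
  have h1 := congrArg (C.D V) (h.two_mul_ricci Y Z)
  simp only [neg_mul, map_sub, map_neg, C.D_mul, map_add, h.D_Λ, h.D_τ, h.D_μ, h2,
    h.lie_ricci_eq] at h1
  rw [← h.D_η_sub, ← h.D_η_sub, ← h.lieMetric_eq_mul, lieMetric]
  linear_combination -h1 + h.two_mul_ricci ⁅V, Y⁆ Z + h.two_mul_ricci Y ⁅V, Z⁆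

/-- Either `τ` vanishes or `Λ + τ = -4`. -/
theorem mul_eq_zero : τ * (Λ + τ + 4) * (2 * n) = 0 := by
  -- Arguments in the image of `φ` remove every `η` term, and with them the unknown `[V, ξ]`.
  have h1 (Y Z : 𝔛) : τ * (Λ + τ + 4) * (C.g Y Z - C.η Y * C.η Z) = 0 := by
    have h2 := h.lie_ricci_combination (C.φ Y) (C.φ Z)
    rw [C.η_φ, C.η_φ, C.g_φ_φ] at h2
    linear_combination h2
  -- A trace extracts the scalar without choosing a non-null vector: the projection along `ξ` has
  -- trace `2n`.
  have h3 : (τ * (Λ + τ + 4)) • (LinearMap.id - C.η.smulRight C.ξ) = 0 := by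
    ext Y
    refine C.ext_g fun Z ↦ ?_
    simpa [C.g_ξ_left] using h1 Y Z
  have h4 := congrArg C.tr h3
  rw [map_smul, map_sub, C.tr_id, C.tr_smulRight, C.η_ξ, map_zero, smul_eq_mul] at h4
  linear_combination h4

/-- If `Λ + τ = -4`, then `V` preserves `φ`. -/
theorem lie_φ (hΛ : Λ + τ = -4) (X : 𝔛) : ⁅V, C.φ X⁆ = C.φ ⁅V, X⁆ := by
  -- Putting `ξ` in one slot of `lie_ricci_combination` isolates `g(Y, [V, ξ])` with coefficient `2μ
  -- + τ = 4n + 4`, a unit.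
  have hξ : ⁅V, C.ξ⁆ = -(τ • C.ξ) := by
    refine C.ext_g fun Y ↦ ?_
    have hu : IsUnit (4 * n + 4 : A) := by
      have := (IsUnit.mk0 (4 * n + 4 : ℝ) (by positivity)).map (algebraMap ℝ A)
      simpa [map_ofNat] using this
    have h1 := h.lie_ricci_combination Y C.ξ
    rw [C.η_ξ, C.g_ξ, C.g_ξ_left, h.η_lie_ξ] at h1
    rw [C.g_comm, map_neg, LinearMap.neg_apply, map_smul, LinearMap.smul_apply, C.g_ξ_left,
      smul_eq_mul]
    apply hu.mul_left_cancel
    have hμ : 2 * μ + τ = 4 * n + 4 := by linear_combination h.two_τ - hΛ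
    rw [hμ] at h1
    linear_combination -h1 - 2 * τ * C.η Y * hΛ
  -- By definition `Γ(X, ξ) = -[V, φX] + φ[V, X] - τφX`, while `lieNabla_eq` gives `-τφX`.
  have h1 := h.lieNabla_eq X C.ξ
  rw [lieNabla, C.nabla_ξ, C.nabla_ξ, hξ, C.nabla_neg_right, C.nabla_smul_right, C.nabla_ξ, h.D_τ,
    C.φ_ξ, C.η_ξ, lie_neg] at h1
  exact sub_eq_zero.1 (Eq.trans (by module) (sub_eq_zero.2 h1.symm))

end IsSoliton
end ParaSasakianCalculus
-- The Lie ring of smooth vector fields and its action on functions.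
section SmoothFields

variable {m : ℕ} {M : Type*} [TopologicalSpace M] [ChartedSpace (EuclideanSpace ℝ (Fin m)) M]
  [IsManifold (𝓡 m) ∞ M]

variable (m M) in
/-- The ring of smooth functions. -/
abbrev SmoothFn : Type _ := C^∞⟮𝓡 m, M; 𝓘(ℝ, ℝ), ℝ⟯

variable (m M) in
/-- The smooth vector fields. -/
abbrev SmoothVF : Type _ :=
  Cₛ^∞⟮𝓡 m; EuclideanSpace ℝ (Fin m), fun x : M ↦ TangentSpace (𝓡 m) x⟯

theorem SmoothVF.diffFieldAt (X : SmoothVF m M) (x : M) : DiffFieldAt (m := m) X x :=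
  X.mdifferentiableAt

theorem SmoothFn.mdifferentiableAt (f : SmoothFn m M) (x : M) :
    MDifferentiableAt (𝓡 m) 𝓘(ℝ, ℝ) f x :=
  (f.contMDiff x).mdifferentiableAt (by simp)

instance : SMul (SmoothFn m M) (SmoothVF m M) where
  smul f X := ⟨fun x ↦ f x • X x, f.contMDiff.smul_section X.contMDiff⟩

@[simp]
theorem SmoothVF.smul_apply (f : SmoothFn m M) (X : SmoothVF m M) (x : M) :
    (f • X) x = f x • X x := rfl

@[simp]
theorem SmoothVF.add_apply (X Y : SmoothVF m M) (x : M) : (X + Y) x = X x + Y x := rfl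

@[simp]
theorem SmoothVF.sub_apply (X Y : SmoothVF m M) (x : M) : (X - Y) x = X x - Y x := rfl

@[simp]
theorem SmoothVF.neg_apply (X : SmoothVF m M) (x : M) : (-X) x = -X x := rfl

@[simp]
theorem SmoothVF.zero_apply (x : M) : (0 : SmoothVF m M) x = 0 := rfl

@[simp]
theorem SmoothVF.sum_apply {ι : Type*} (s : Finset ι) (X : ι → SmoothVF m M) (x : M) :
    (∑ i ∈ s, X i) x = ∑ i ∈ s, X i x := by
  have := map_sum (ContMDiffSection.coeAddHom (𝓡 m) (EuclideanSpace ℝ (Fin m)) ∞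
    (fun x : M ↦ TangentSpace (𝓡 m) x)) X s
  exact (congrFun this x).trans (Finset.sum_apply _ _ _)

theorem SmoothFn.sum_apply {ι : Type*} (s : Finset ι) (f : ι → SmoothFn m M) (x : M) :
    (∑ i ∈ s, f i) x = ∑ i ∈ s, f i x := by
  exact (congrFun (map_sum ContMDiffMap.coeFnAddMonoidHom f s) x).trans (Finset.sum_apply _ _ _)

instance : Module (SmoothFn m M) (SmoothVF m M) where
  one_smul X := by ext x : 1; exact one_smul ℝ (X x)
  mul_smul f g X := by ext x : 1; exact mul_smul (f x) (g x) (X x)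
  smul_zero f := by ext x : 1; exact smul_zero (f x)
  smul_add f X Y := by ext x : 1; exact smul_add (f x) (X x) (Y x)
  add_smul f g X := by ext x : 1; exact add_smul (f x) (g x) (X x)
  zero_smul X := by ext x : 1; exact zero_smul ℝ (X x)

variable (m M) in
theorem isManifold_minSmoothness (k : ℕ) : IsManifold (𝓡 m) (minSmoothness ℝ k) M := by
  rw [minSmoothness_of_isRCLikeNormedField]
  exact IsManifold.of_le (n := ∞) (by exact_mod_cast le_top)

instance : Bracket (SmoothVF m M) (SmoothVF m M) where
  bracket X Y := ⟨bracket X Y, fun x ↦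
    haveI := isManifold_minSmoothness m M 2
    haveI : IsManifold (𝓡 m) ((⊤ : ℕ∞) + 1) M := inferInstanceAs (IsManifold (𝓡 m) ∞ M)
    ContMDiffAt.mlieBracket_vectorField (n := ⊤) (m := ⊤) (X.contMDiff x) (Y.contMDiff x) (by simp)⟩

instance : LieRing (SmoothVF m M) where
  add_lie X Y Z := by
    ext x : 1
    exact mlieBracket_add_left (X.diffFieldAt x) (Y.diffFieldAt x)
  lie_add X Y Z := by
    ext x : 1
    exact mlieBracket_add_right (Y.diffFieldAt x) (Z.diffFieldAt x)
  lie_self X := by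
    ext x : 1
    have h := mlieBracket_swap_apply (I := 𝓡 m) (V := ⇑X) (W := ⇑X) (x := x)
    have h2 : (2 : ℝ) • mlieBracket (𝓡 m) X X x = 0 := by
      rw [two_smul]
      exact eq_neg_iff_add_eq_zero.1 h
    exact (smul_eq_zero.1 h2).resolve_left two_ne_zero
  leibniz_lie X Y Z := by
    ext x : 1
    have h (W : SmoothVF m M) := (W.contMDiff x).of_le
      (show minSmoothness ℝ 2 ≤ ∞ by
        rw [minSmoothness_of_isRCLikeNormedField]; exact ENat.LEInfty.out)
    have := isManifold_minSmoothness m M 3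
    exact leibniz_identity_mlieBracket_apply (h X) (h Y) (h Z)

/-- The derivative of a smooth function along a smooth vector field. -/
def SmoothVF.deriv (X : SmoothVF m M) (f : SmoothFn m M) : SmoothFn m M :=
  ⟨dirDeriv (m := m) X f,
    (contMDiff_snd_tangentBundle_modelSpace ℝ 𝓘(ℝ, ℝ)).comp
      ((f.contMDiff.contMDiff_tangentMap (m := ∞) (by simp)).comp X.contMDiff)⟩

theorem SmoothVF.deriv_apply (X : SmoothVF m M) (f : SmoothFn m M) (x : M) :
    X.deriv f x = mvfderiv (𝓡 m) f x (X x) := rfl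

/-- Smooth vector fields as derivations of the ring of smooth functions. -/
def SmoothVF.derivation :
    SmoothVF m M →ₗ[SmoothFn m M] Derivation ℝ (SmoothFn m M) (SmoothFn m M) where
  toFun X := Derivation.mk'
    { toFun := X.deriv
      map_add' := fun f g ↦ by
        ext x
        have := mvfderiv_add (f.mdifferentiableAt x) (g.mdifferentiableAt x)
        exact congr($this (X x))
      map_smul' := fun c f ↦ by
        ext x
        have := mvfderiv_smul (mdifferentiableAt_const (c := c)) (f.mdifferentiableAt x)
        rw [mvfderiv_const] at this
        refine congr($this (X x)).trans ?_
        simp [SmoothVF.deriv_apply] }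
    fun f g ↦ by
      ext x
      have := mvfderiv_mul (f.mdifferentiableAt x) (g.mdifferentiableAt x)
      exact congr($this (X x))
  map_add' X Y := by
    ext f x
    exact map_add (mvfderiv (𝓡 m) f x) (X x) (Y x)
  map_smul' a X := by
    ext f x
    exact map_smul (mvfderiv (𝓡 m) f x) (a x) (X x)

theorem SmoothVF.derivation_apply (X : SmoothVF m M) (f : SmoothFn m M) (x : M) :
    SmoothVF.derivation X f x = mvfderiv (𝓡 m) f x (X x) := rfl

theorem SmoothVF.lie_smul' (X : SmoothVF m M) (f : SmoothFn m M) (Y : SmoothVF m M) :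
    ⁅X, f • Y⁆ = SmoothVF.derivation X f • Y + f • ⁅X, Y⁆ := by
  ext x : 1
  exact mlieBracket_smul_right (f.mdifferentiableAt x) (Y.diffFieldAt x)

end SmoothFields
-- Bump functions, localized frames and tensoriality.
section Frames

open Filter Topology

variable {m : ℕ} {M : Type*} [TopologicalSpace M] [ChartedSpace (EuclideanSpace ℝ (Fin m)) M]
  [IsManifold (𝓡 m) ∞ M]

variable (m) in
/-- The coordinate frame of the trivialization of the tangent bundle at `x₀`. -/
def coordFrame (x₀ : M) (i : Fin m) : VField m M :=
  (trivializationAt (EuclideanSpace ℝ (Fin m)) (TangentSpace (𝓡 m)) x₀).localFrame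
    (EuclideanSpace.basisFun (Fin m) ℝ).toBasis i

variable (m) in
/-- The dual coframe of `coordFrame`. -/
def coordCoframe (x₀ : M) (i : Fin m) (x : M) : TangentSpace (𝓡 m) x →ₗ[ℝ] ℝ :=
  (trivializationAt (EuclideanSpace ℝ (Fin m)) (TangentSpace (𝓡 m)) x₀).localFrameCoeff (𝓡 m)
    (EuclideanSpace.basisFun (Fin m) ℝ).toBasis i x

variable (m) in
/-- The open set on which `coordFrame` is a frame. -/
def coordSet (x₀ : M) : Set M :=
  (trivializationAt (EuclideanSpace ℝ (Fin m)) (TangentSpace (𝓡 m)) x₀).baseSet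

theorem isOpen_coordSet (x₀ : M) : IsOpen (coordSet m x₀) :=
  (trivializationAt (EuclideanSpace ℝ (Fin m)) (TangentSpace (𝓡 m)) x₀).open_baseSet

theorem mem_coordSet (x₀ : M) : x₀ ∈ coordSet m x₀ :=
  FiberBundle.mem_baseSet_trivializationAt' x₀

theorem contMDiffOn_coordFrame (x₀ : M) (i : Fin m) :
    ContMDiffOn (𝓡 m) ((𝓡 m).prod 𝓘(ℝ, EuclideanSpace ℝ (Fin m))) ∞
      (fun x ↦ Bundle.TotalSpace.mk' (EuclideanSpace ℝ (Fin m)) x (coordFrame m x₀ i x))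
      (coordSet m x₀) :=
  Bundle.Trivialization.contMDiffOn_localFrame_baseSet _ _ _ _

theorem eq_sum_coordFrame {x₀ x : M} (hx : x ∈ coordSet m x₀) (X : VField m M) :
    X x = ∑ i, coordCoframe m x₀ i x (X x) • coordFrame m x₀ i x :=
  Bundle.Trivialization.eq_sum_localFrameCoeff_smul hx

theorem coordCoframe_coordFrame {x₀ x : M} (hx : x ∈ coordSet m x₀) (i j : Fin m) :
    coordCoframe m x₀ i x (coordFrame m x₀ j x) = if j = i then 1 else 0 := by
  unfold coordCoframe
  rw [Bundle.Trivialization.localFrameCoeff_apply_of_mem_baseSet _ _ hx, coordFrame,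
    Bundle.Trivialization.localFrame_apply_of_mem_baseSet _ _ hx, Module.Basis.repr_self,
    Finsupp.single_apply]

theorem contMDiffAt_iff_coordCoframe {x₀ x : M} (hx : x ∈ coordSet m x₀) (X : VField m M) :
    ContMDiffAt (𝓡 m) ((𝓡 m).prod 𝓘(ℝ, EuclideanSpace ℝ (Fin m))) ∞
      (fun x ↦ Bundle.TotalSpace.mk' (EuclideanSpace ℝ (Fin m)) x (X x)) x ↔
    ∀ i, ContMDiffAt (𝓡 m) 𝓘(ℝ, ℝ) ∞ (fun x ↦ coordCoframe m x₀ i x (X x)) x :=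
  contMDiffAt_iff_localFrameCoeff _ hx

variable [T2Space M]

theorem exists_bump {x₀ : M} {s : Set M} (hs : s ∈ 𝓝 x₀) :
    ∃ ψ : SmoothFn m M, ψ =ᶠ[𝓝 x₀] 1 ∧ tsupport ψ ⊆ s := by
  obtain ⟨f, -, hf⟩ := (SmoothBumpFunction.nhds_basis_tsupport (I := 𝓡 m) x₀).mem_iff.1 hs
  exact ⟨⟨f, f.contMDiff⟩, f.eventuallyEq_one, hf⟩

/-- A vector field which is smooth near a point agrees near this point with a smooth vector
field. -/
theorem exists_smoothVF_eventuallyEq {x₀ : M} {s : Set M} (hs : s ∈ 𝓝 x₀) {X : VField m M}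
    (hX : ContMDiffOn (𝓡 m) ((𝓡 m).prod 𝓘(ℝ, EuclideanSpace ℝ (Fin m))) ∞
      (fun x ↦ Bundle.TotalSpace.mk' (EuclideanSpace ℝ (Fin m)) x (X x)) s) :
    ∃ Y : SmoothVF m M, ∀ᶠ x in 𝓝 x₀, Y x = X x := by
  obtain ⟨ψ, h1, h2⟩ := exists_bump (m := m) (interior_mem_nhds.2 hs)
  refine ⟨⟨fun x ↦ ψ x • X x, ContMDiffOn.smul_section_of_tsupport ψ.contMDiff.contMDiffOn
    isOpen_interior h2 (hX.mono interior_subset)⟩, ?_⟩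
  filter_upwards [h1] with x hx
  change ψ x • X x = X x
  rw [hx, Pi.one_apply, one_smul]

theorem exists_smoothVF_extend {x : M} (v : TangentSpace (𝓡 m) x) :
    ∃ Y : SmoothVF m M, ∀ᶠ y in 𝓝 x, Y y = extend (EuclideanSpace ℝ (Fin m)) v y := by
  obtain ⟨s, hs, h⟩ := exists_contMDiffOn_extend (k := ∞) (𝓡 m) (EuclideanSpace ℝ (Fin m)) v
  exact exists_smoothVF_eventuallyEq hs h

theorem exists_smoothVF_apply_eq {x : M} (v : TangentSpace (𝓡 m) x) :
    ∃ Y : SmoothVF m M, Y x = v := by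
  obtain ⟨Y, hY⟩ := exists_smoothVF_extend v
  exact ⟨Y, hY.self_of_nhds.trans (extend_apply_self ..)⟩

/-- Localized frames and coframes. -/
theorem exists_frame (x₀ : M) : ∃ (χ : SmoothFn m M) (E : Fin m → SmoothVF m M)
    (θ : Fin m → SmoothVF m M →ₗ[SmoothFn m M] SmoothFn m M), χ =ᶠ[𝓝 x₀] 1 ∧
      (∀ X, χ • X = ∑ i, θ i X • E i) ∧ ∀ i X, X x₀ = 0 → θ i X x₀ = 0 := by
  obtain ⟨ψ, h1, h2⟩ := exists_bump (m := m)
    ((isOpen_coordSet (m := m) x₀).mem_nhds (mem_coordSet x₀))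
  -- Both the frame and the coframe are cut off by `ψ`, so the expansion produces `ψ²`.
  refine ⟨ψ * ψ, fun i ↦ ⟨fun x ↦ ψ x • coordFrame m x₀ i x,
    ContMDiffOn.smul_section_of_tsupport ψ.contMDiff.contMDiffOn
    (isOpen_coordSet x₀) h2 (contMDiffOn_coordFrame x₀ i)⟩, fun i ↦
    { toFun := fun X ↦ ⟨fun x ↦ ψ x • coordCoframe m x₀ i x (X x),
        contMDiff_of_tsupport fun x hx ↦ ?_⟩
      map_add' := fun X Y ↦ ?_
      map_smul' := fun f X ↦ ?_}, ?_, fun X ↦ ?_, fun i X hX ↦ ?_⟩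
  · exact (ψ.contMDiff x).smul ((contMDiffAt_iff_coordCoframe
      (h2 (tsupport_smul_subset_left _ _ hx)) X).1 (X.contMDiff x) i)
  · ext x
    change ψ x • coordCoframe m x₀ i x (X x + Y x) = ψ x • coordCoframe m x₀ i x (X x)
      + ψ x • coordCoframe m x₀ i x (Y x)
    rw [map_add, smul_add]
  · ext x
    change ψ x • coordCoframe m x₀ i x (f x • X x) = f x * (ψ x • coordCoframe m x₀ i x (X x))
    rw [map_smul, smul_eq_mul, smul_eq_mul, smul_eq_mul]
    ring
  · filter_upwards [h1] with x hx
    change ψ x * ψ x = 1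
    rw [hx, Pi.one_apply, one_mul]
  · ext x : 1
    rw [SmoothVF.sum_apply]
    change (ψ x * ψ x) • X x =
      ∑ i, (ψ x • coordCoframe m x₀ i x (X x)) • (ψ x • coordFrame m x₀ i x)
    by_cases hx : x ∈ coordSet m x₀
    · conv_lhs => rw [eq_sum_coordFrame hx X]
      rw [Finset.smul_sum]
      refine Finset.sum_congr rfl fun i _ ↦ ?_
      rw [smul_smul, smul_smul, smul_eq_mul]
      congr 1
      ring
    · have : ψ x = 0 := image_eq_zero_of_notMem_tsupport fun h ↦ hx (h2 h)
      simp [this]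
  · change ψ x₀ • coordCoframe m x₀ i x₀ (X x₀) = 0
    rw [hX, map_zero, smul_zero]

/-- A map on smooth vector fields which is homogeneous with respect to the values of functions at
`x` only depends on the values of vector fields at `x`. -/
theorem eq_zero_of_apply_eq_zero {U : Type*} [AddCommGroup U] [Module ℝ U] {x : M}
    (F : SmoothVF m M →+ U) (hF : ∀ (f : SmoothFn m M) X, F (f • X) = f x • F X)
    {X : SmoothVF m M} (hX : X x = 0) : F X = 0 := by
  obtain ⟨χ, E, θ, h1, h2, h3⟩ := exists_frame (m := m) x
  have h4 := hF χ X
  rw [h2, map_sum, h1.eq_of_nhds, Pi.one_apply, one_smul] at h4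
  rw [← h4]
  exact Finset.sum_eq_zero fun i _ ↦ by rw [hF, h3 i X hX, zero_smul]

theorem eq_of_apply_eq {U : Type*} [AddCommGroup U] [Module ℝ U] {x : M}
    (F : SmoothVF m M →+ U) (hF : ∀ (f : SmoothFn m M) X, F (f • X) = f x • F X)
    {X Y : SmoothVF m M} (hX : X x = Y x) : F X = F Y := by
  rw [← sub_eq_zero, ← map_sub]
  exact eq_zero_of_apply_eq_zero F hF (by rw [SmoothVF.sub_apply, hX, sub_self])

/-- The linear map on a tangent space induced by a tensorial map. -/
def pointwise {U : Type*} [AddCommGroup U] [Module ℝ U] {x : M}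
    (F : SmoothVF m M →+ U) (hF : ∀ (f : SmoothFn m M) X, F (f • X) = f x • F X) :
    TangentSpace (𝓡 m) x →ₗ[ℝ] U where
  toFun v := F (exists_smoothVF_apply_eq v).choose
  map_add' u v := by
    rw [← map_add]
    refine eq_of_apply_eq F hF ?_
    rw [SmoothVF.add_apply, (exists_smoothVF_apply_eq u).choose_spec,
      (exists_smoothVF_apply_eq v).choose_spec, (exists_smoothVF_apply_eq (u + v)).choose_spec]
  map_smul' c u := by
    refine Eq.trans (eq_of_apply_eq F hF ?_)
      (hF (algebraMap ℝ (SmoothFn m M) c) (exists_smoothVF_apply_eq u).choose)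
    rw [SmoothVF.smul_apply, (exists_smoothVF_apply_eq u).choose_spec,
      (exists_smoothVF_apply_eq (c • u)).choose_spec]
    rfl

theorem pointwise_apply {U : Type*} [AddCommGroup U] [Module ℝ U] {x : M}
    (F : SmoothVF m M →+ U) (hF : ∀ (f : SmoothFn m M) X, F (f • X) = f x • F X)
    (X : SmoothVF m M) : pointwise F hF (X x) = F X :=
  eq_of_apply_eq F hF (exists_smoothVF_apply_eq (X x)).choose_spec

/-- The endomorphism of a tangent space induced by a field of endomorphisms. -/
def evalEnd (T : SmoothVF m M →ₗ[SmoothFn m M] SmoothVF m M) (x : M) :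
    TangentSpace (𝓡 m) x →ₗ[ℝ] TangentSpace (𝓡 m) x :=
  pointwise (x := x) ⟨⟨fun X ↦ T X x, by simp⟩, by simp⟩ (by simp)

@[simp]
theorem evalEnd_apply (T : SmoothVF m M →ₗ[SmoothFn m M] SmoothVF m M) (X : SmoothVF m M) (x : M) :
    evalEnd T x (X x) = T X x :=
  pointwise_apply _ _ X

/-- The linear form on a tangent space induced by a one-form. -/
def evalForm (α : SmoothVF m M →ₗ[SmoothFn m M] SmoothFn m M) (x : M) :
    TangentSpace (𝓡 m) x →ₗ[ℝ] ℝ :=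
  pointwise (x := x) ⟨⟨fun X ↦ α X x, by simp⟩, by simp⟩ (by simp)

@[simp]
theorem evalForm_apply (α : SmoothVF m M →ₗ[SmoothFn m M] SmoothFn m M) (X : SmoothVF m M)
    (x : M) : evalForm α x (X x) = α X x :=
  pointwise_apply _ _ X

theorem tangent_linearMap_ext {U : Type*} [AddCommGroup U] [Module ℝ U] {x : M}
    {S T : TangentSpace (𝓡 m) x →ₗ[ℝ] U} (h : ∀ X : SmoothVF m M, S (X x) = T (X x)) : S = T := by
  ext v
  obtain ⟨X, rfl⟩ := exists_smoothVF_apply_eq v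
  exact h X

/-- The Jacobi identity for `X`, `Y` and `f • Z` gives the formula multiplied by `Z`; a field `Z`
not vanishing at the point then cancels. On a zero tangent space both sides vanish. -/
theorem SmoothVF.derivation_lie (X Y : SmoothVF m M) (f : SmoothFn m M) :
    SmoothVF.derivation ⁅X, Y⁆ f = SmoothVF.derivation X (SmoothVF.derivation Y f)
      - SmoothVF.derivation Y (SmoothVF.derivation X f) := by
  have key (Z : SmoothVF m M) : (SmoothVF.derivation ⁅X, Y⁆ f) • Z =
      (SmoothVF.derivation X (SmoothVF.derivation Y f)
      - SmoothVF.derivation Y (SmoothVF.derivation X f)) • Z := by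
    have h := leibniz_lie X Y (f • Z)
    simp only [SmoothVF.lie_smul', lie_add, leibniz_lie X Y Z] at h
    rw [← sub_eq_zero] at h ⊢
    rw [← neg_eq_zero, ← h]
    module
  ext x
  rcases subsingleton_or_nontrivial (TangentSpace (𝓡 m) x) with hs | hs
  · simp only [ContMDiffMap.coe_sub, Pi.sub_apply, SmoothVF.derivation_apply]
    simp [Subsingleton.elim _ (0 : TangentSpace (𝓡 m) x)]
  · obtain ⟨v, hv⟩ := exists_ne (0 : TangentSpace (𝓡 m) x)
    obtain ⟨Z, rfl⟩ := exists_smoothVF_apply_eq v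
    have := congrArg (fun W : SmoothVF m M ↦ W x) (key Z)
    exact smul_left_injective ℝ hv this

end Frames
-- The trace of endomorphism fields and its Lie derivative.
section Trace

open Filter Topology

variable {m : ℕ} {M : Type*} [TopologicalSpace M] [ChartedSpace (EuclideanSpace ℝ (Fin m)) M]
  [IsManifold (𝓡 m) ∞ M] [T2Space M]

instance (x : M) : FiniteDimensional ℝ (TangentSpace (𝓡 m) x) :=
  inferInstanceAs (FiniteDimensional ℝ (EuclideanSpace ℝ (Fin m)))

theorem evalEnd_add (S T : SmoothVF m M →ₗ[SmoothFn m M] SmoothVF m M) (x : M) :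
    evalEnd (S + T) x = evalEnd S x + evalEnd T x :=
  tangent_linearMap_ext fun X ↦ by simp

theorem evalEnd_smul (f : SmoothFn m M) (T : SmoothVF m M →ₗ[SmoothFn m M] SmoothVF m M) (x : M) :
    evalEnd (f • T) x = f x • evalEnd T x :=
  tangent_linearMap_ext fun X ↦ by simp

theorem evalEnd_comp (S T : SmoothVF m M →ₗ[SmoothFn m M] SmoothVF m M) (x : M) :
    evalEnd (S ∘ₗ T) x = evalEnd S x ∘ₗ evalEnd T x :=
  tangent_linearMap_ext fun X ↦ by simp

theorem evalEnd_id (x : M) :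
    evalEnd (LinearMap.id : SmoothVF m M →ₗ[SmoothFn m M] SmoothVF m M) x = LinearMap.id :=
  tangent_linearMap_ext fun X ↦ by simp

theorem evalEnd_smulRight (α : SmoothVF m M →ₗ[SmoothFn m M] SmoothFn m M) (W : SmoothVF m M)
    (x : M) : evalEnd (α.smulRight W) x = (evalForm α x).smulRight (W x) :=
  tangent_linearMap_ext fun X ↦ by simp

theorem trace_evalEnd_smulRight (α : SmoothVF m M →ₗ[SmoothFn m M] SmoothFn m M)
    (W : SmoothVF m M) (x : M) :
    LinearMap.trace ℝ _ (evalEnd (α.smulRight W) x) = α W x := by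
  rw [evalEnd_smulRight, LinearMap.trace_smulRight, evalForm_apply]

theorem smul_eq_sum_smulRight {χ : SmoothFn m M} {E : Fin m → SmoothVF m M}
    {θ : Fin m → SmoothVF m M →ₗ[SmoothFn m M] SmoothFn m M}
    (h : ∀ X, χ • X = ∑ i, θ i X • E i) (T : SmoothVF m M →ₗ[SmoothFn m M] SmoothVF m M) :
    χ • T = ∑ i, (θ i ∘ₗ T).smulRight (E i) := by
  ext X : 1
  simp [h, LinearMap.sum_apply]

/-- The trace of a field of endomorphisms. -/
def fieldTrace (T : SmoothVF m M →ₗ[SmoothFn m M] SmoothVF m M) : SmoothFn m M where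
  val x := LinearMap.trace ℝ _ (evalEnd T x)
  property x := by
    obtain ⟨χ, E, θ, h1, h2, -⟩ := exists_frame (m := m) x
    -- Where `χ = 1`, the field `T` is a sum of rank-one maps, so its trace is this visibly smooth
    -- function.
    refine ((∑ i, θ i (T (E i))).contMDiff x).congr_of_eventuallyEq ?_
    filter_upwards [h1] with y hy
    have h3 := congrArg (fun S ↦ LinearMap.trace ℝ _ (evalEnd S y)) (smul_eq_sum_smulRight h2 T)
    simp only [evalEnd_smul, hy, Pi.one_apply, one_smul] at h3
    rw [h3, SmoothFn.sum_apply]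
    have h4 : evalEnd (∑ i, (θ i ∘ₗ T).smulRight (E i)) y
        = ∑ i, evalEnd ((θ i ∘ₗ T).smulRight (E i)) y :=
      map_sum (AddMonoidHom.mk' (fun S ↦ evalEnd (m := m) (M := M) S y)
        fun S S' ↦ evalEnd_add S S' y) _ _
    rw [h4, map_sum]
    exact Finset.sum_congr rfl fun i _ ↦ trace_evalEnd_smulRight _ _ _

variable (m M) in
/-- The trace as a linear map. -/
def fieldTraceLinear :
    (SmoothVF m M →ₗ[SmoothFn m M] SmoothVF m M) →ₗ[SmoothFn m M] SmoothFn m M where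
  toFun := fieldTrace
  map_add' S T := by
    ext x
    exact (congrArg (LinearMap.trace ℝ _) (evalEnd_add S T x)).trans (map_add ..)
  map_smul' f T := by
    ext x
    exact (congrArg (LinearMap.trace ℝ _) (evalEnd_smul f T x)).trans (map_smul ..)

theorem fieldTraceLinear_apply (T : SmoothVF m M →ₗ[SmoothFn m M] SmoothVF m M) (x : M) :
    fieldTraceLinear m M T x = LinearMap.trace ℝ _ (evalEnd T x) := rfl

theorem fieldTrace_comp_comm (S T : SmoothVF m M →ₗ[SmoothFn m M] SmoothVF m M) :
    fieldTraceLinear m M (S ∘ₗ T) = fieldTraceLinear m M (T ∘ₗ S) := by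
  ext x
  rw [fieldTraceLinear_apply, fieldTraceLinear_apply, evalEnd_comp, evalEnd_comp]
  exact LinearMap.trace_mul_comm _ _ _

theorem fieldTrace_smulRight (α : SmoothVF m M →ₗ[SmoothFn m M] SmoothFn m M)
    (W : SmoothVF m M) : fieldTraceLinear m M (α.smulRight W) = α W := by
  ext x
  exact trace_evalEnd_smulRight α W x

theorem fieldTrace_id :
    fieldTraceLinear m M LinearMap.id = (m : SmoothFn m M) := by
  ext x
  rw [fieldTraceLinear_apply, evalEnd_id, LinearMap.trace_id]
  have h : Module.finrank ℝ (TangentSpace (𝓡 m) x) = m :=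
    (finrank_euclideanSpace (𝕜 := ℝ) (ι := Fin m)).trans (Fintype.card_fin m)
  rw [h]
  exact (congrFun (map_natCast (ContMDiffMap.coeFnRingHom (I := 𝓡 m) (N := M) (I' := 𝓘(ℝ, ℝ))
    (R := ℝ) (n := ∞)) m) x).symm

/-- `χ • S` is a sum of rank-one maps `α ⊗ E`, for which the claim is the Leibniz rule for
`V(α(E))`. The terms in `V χ` cancel, and `χ = 1` at the point. -/
theorem derivation_fieldTrace (V : SmoothVF m M)
    (S T : SmoothVF m M →ₗ[SmoothFn m M] SmoothVF m M) (hT : ∀ X, T X = ⁅V, S X⁆ - S ⁅V, X⁆) :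
    SmoothVF.derivation V (fieldTraceLinear m M S) = fieldTraceLinear m M T := by
  ext x
  obtain ⟨χ, E, θ, h1, h2, -⟩ := exists_frame (m := m) x
  -- `β i` is the Lie derivative of the one-form `θ i ∘ S`.
  let β (i : Fin m) : SmoothVF m M →ₗ[SmoothFn m M] SmoothFn m M :=
    { toFun := fun X ↦ SmoothVF.derivation V (θ i (S X)) - θ i (S ⁅V, X⁆)
      map_add' := fun X Y ↦ by
        simp only [map_add, lie_add]
        ring
      map_smul' := fun f X ↦ by
        simp only [map_smul, map_add, SmoothVF.lie_smul', smul_eq_mul, Derivation.leibniz,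
          RingHom.id_apply]
        ring }
  have h3 : χ • T + SmoothVF.derivation V χ • S =
      ∑ i, ((β i).smulRight (E i) + (θ i ∘ₗ S).smulRight ⁅V, E i⁆) := by
    ext X : 1
    have h4 : ⁅V, χ • S X⁆ - χ • S ⁅V, X⁆ = ∑ i, (β i X • E i + θ i (S X) • ⁅V, E i⁆) := by
      rw [h2, h2, lie_sum, ← Finset.sum_sub_distrib]
      refine Finset.sum_congr rfl fun i _ ↦ ?_
      rw [SmoothVF.lie_smul']
      simp only [β, LinearMap.coe_mk, AddHom.coe_mk]
      module
    rw [SmoothVF.lie_smul'] at h4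
    simp only [LinearMap.add_apply, LinearMap.smul_apply, LinearMap.sum_apply,
      LinearMap.smulRight_apply, LinearMap.comp_apply]
    rw [← h4, hT]
    module
  have h5 : χ * fieldTraceLinear m M T + SmoothVF.derivation V χ * fieldTraceLinear m M S =
      SmoothVF.derivation V (χ * fieldTraceLinear m M S) := by
    rw [← smul_eq_mul, ← smul_eq_mul, ← map_smul, ← map_smul, ← map_add, h3,
      ← smul_eq_mul, ← map_smul (fieldTraceLinear m M), smul_eq_sum_smulRight h2, map_sum, map_sum,
      map_sum]
    refine Finset.sum_congr rfl fun i _ ↦ ?_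
    rw [map_add, fieldTrace_smulRight, fieldTrace_smulRight, fieldTrace_smulRight]
    simp only [β, LinearMap.coe_mk, AddHom.coe_mk, LinearMap.comp_apply]
    ring
  rw [Derivation.leibniz, smul_eq_mul, smul_eq_mul] at h5
  have h6 : χ * fieldTraceLinear m M T = χ * SmoothVF.derivation V (fieldTraceLinear m M S) := by
    linear_combination h5
  have h7 := congrArg (fun f : SmoothFn m M ↦ f x) h6
  simp only [ContMDiffMap.coe_mul, Pi.mul_apply, h1.eq_of_nhds, Pi.one_apply, one_mul] at h7
  exact h7.symm

end Trace

/-- The form identifies `U` with its dual and conjugates `S` into the transpose of `T`. -/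
theorem trace_eq_of_adjoint {U : Type*} [AddCommGroup U] [Module ℝ U] [FiniteDimensional ℝ U]
    (B : U →ₗ[ℝ] U →ₗ[ℝ] ℝ) (hB : ∀ u, (∀ v, B u v = 0) → u = 0) (S T : U →ₗ[ℝ] U)
    (h : ∀ u v, B (S u) v = B u (T v)) : LinearMap.trace ℝ U S = LinearMap.trace ℝ U T := by
  have hinj : Function.Injective B := by
    rw [injective_iff_map_eq_zero]
    exact fun u hu ↦ hB u fun v ↦ LinearMap.congr_fun hu v
  let e : U ≃ₗ[ℝ] Module.Dual ℝ U :=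
    LinearEquiv.ofInjectiveOfFinrankEq B hinj Subspace.dual_finrank_eq.symm
  have he : e.conj S = Module.Dual.transpose (R := ℝ) T := by
    ext f v
    obtain ⟨u, rfl⟩ := e.surjective f
    rw [LinearEquiv.conj_apply_apply, e.symm_apply_apply]
    exact h u v
  rw [← LinearMap.trace_conj' S e, he, LinearMap.trace_transpose']

/-! ### Smoothness of a field from its products with smooth fields. -/

section Metric

open Filter Topology

variable {m : ℕ} {M : Type*} [TopologicalSpace M] [ChartedSpace (EuclideanSpace ℝ (Fin m)) M]
  [IsManifold (𝓡 m) ∞ M]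

theorem contMDiffAt_matrix_det {k : ℕ} {A : M → Matrix (Fin k) (Fin k) ℝ} {x : M}
    (h : ∀ i j, ContMDiffAt (𝓡 m) 𝓘(ℝ, ℝ) ∞ (fun y ↦ A y i j) x) :
    ContMDiffAt (𝓡 m) 𝓘(ℝ, ℝ) ∞ (fun y ↦ (A y).det) x := by
  simp only [Matrix.det_apply, Units.smul_def, zsmul_eq_mul]
  refine contMDiffAt_finsetSum fun σ _ ↦ ?_
  have : ContMDiffAt (𝓡 m) 𝓘(ℝ, ℝ) ∞ (fun y ↦ ∏ i, A y (σ i) i) x :=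
    contMDiffAt_finsetProd fun i _ ↦ h _ _
  exact contMDiffAt_const.mul this

theorem contMDiffAt_matrix_adjugate {k : ℕ} {A : M → Matrix (Fin k) (Fin k) ℝ} {x : M}
    (h : ∀ i j, ContMDiffAt (𝓡 m) 𝓘(ℝ, ℝ) ∞ (fun y ↦ A y i j) x) (i j : Fin k) :
    ContMDiffAt (𝓡 m) 𝓘(ℝ, ℝ) ∞ (fun y ↦ (A y).adjugate i j) x := by
  simp only [Matrix.adjugate_apply]
  refine contMDiffAt_matrix_det fun a b ↦ ?_
  by_cases hab : a = j
  · subst hab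
    simp only [Matrix.updateRow_self]
    exact contMDiffAt_const
  · simp only [Matrix.updateRow_ne hab]
    exact h a b

namespace PseudoMetric

variable (g : PseudoMetric m M)

theorem contMDiffAt_app {X Y : VField m M} {x : M}
    (hX : ContMDiffAt (𝓡 m) ((𝓡 m).prod 𝓘(ℝ, EuclideanSpace ℝ (Fin m))) ∞
      (fun x ↦ Bundle.TotalSpace.mk' (EuclideanSpace ℝ (Fin m)) x (X x)) x)
    (hY : ContMDiffAt (𝓡 m) ((𝓡 m).prod 𝓘(ℝ, EuclideanSpace ℝ (Fin m))) ∞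
      (fun x ↦ Bundle.TotalSpace.mk' (EuclideanSpace ℝ (Fin m)) x (Y x)) x) :
    ContMDiffAt (𝓡 m) 𝓘(ℝ, ℝ) ∞ (g.app X Y) x := by
  have : ContMDiffAt (𝓡 m) ((𝓡 m).prod 𝓘(ℝ, ℝ)) ∞
      (fun y ↦ Bundle.TotalSpace.mk' ℝ (E := Bundle.Trivial M ℝ) y (g.val y (X y) (Y y))) x := by
    apply ContMDiffAt.clm_bundle_apply₂ (F₁ := EuclideanSpace ℝ (Fin m))
      (F₂ := EuclideanSpace ℝ (Fin m)) (b := fun y ↦ y)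
    · exact g.contMDiff x
    · exact hX
    · exact hY
  rw [Bundle.contMDiffAt_totalSpace] at this
  exact this.2

/-- A vector field is smooth if its products with all smooth vector fields are smooth. -/
theorem smoothField_of_app [T2Space M] {X : VField m M}
    (h : ∀ Y : SmoothVF m M, ContMDiff (𝓡 m) 𝓘(ℝ, ℝ) ∞ (g.app X Y)) : SmoothField X := by
  intro x₀
  rw [contMDiffAt_iff_coordCoframe (mem_coordSet x₀)]
  have hmem := (isOpen_coordSet (m := m) x₀).mem_nhds (mem_coordSet x₀)
  let E := coordFrame m x₀
  have hE (i : Fin m) := (contMDiffOn_coordFrame x₀ i).contMDiffAt hmem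
  -- The coefficients `c` of `X` solve a linear system with the Gram matrix `G` and smooth data
  -- `g(X, E i)`. `G` is invertible at `x₀` by nondegeneracy, so Cramer's rule expresses `c`
  -- smoothly nearby.
  let G (x : M) : Matrix (Fin m) (Fin m) ℝ := Matrix.of fun i j ↦ g.app (E i) (E j) x
  let c (x : M) (i : Fin m) : ℝ := coordCoframe m x₀ i x (X x)
  have hG (i j : Fin m) : ContMDiffAt (𝓡 m) 𝓘(ℝ, ℝ) ∞ (fun x ↦ G x i j) x₀ :=
    g.contMDiffAt_app (hE i) (hE j)
  have hk (i : Fin m) : ContMDiffAt (𝓡 m) 𝓘(ℝ, ℝ) ∞ (g.app X (E i)) x₀ := by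
    obtain ⟨Y, hY⟩ := exists_smoothVF_eventuallyEq hmem (contMDiffOn_coordFrame x₀ i)
    refine (h Y x₀).congr_of_eventuallyEq ?_
    filter_upwards [hY] with x hx
    simp only [app, hx, E]
  have hdet : (G x₀).det ≠ 0 := by
    intro h0
    obtain ⟨v, hv, hv0⟩ := Matrix.exists_vecMul_eq_zero_iff.2 h0
    have h1 : ∑ i, v i • E i x₀ = 0 := by
      refine g.nondegenerate x₀ _ fun u ↦ ?_
      obtain ⟨U, rfl⟩ := exists_smoothVF_apply_eq u
      rw [eq_sum_coordFrame (mem_coordSet x₀) U, map_sum]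
      refine Finset.sum_eq_zero fun j _ ↦ ?_
      have h2 := congrFun hv0 j
      simp only [Matrix.vecMul, dotProduct, Pi.zero_apply] at h2
      rw [map_smul, map_sum, sum_apply, smul_eq_mul, mul_eq_zero]
      right
      rw [← h2]
      refine Finset.sum_congr rfl fun i _ ↦ ?_
      rw [map_smul]
      rfl
    apply hv
    ext j
    have h3 := congrArg (coordCoframe m x₀ j x₀) h1
    simpa [map_sum, E, coordCoframe_coordFrame (mem_coordSet x₀)] using h3
  have hdetG := contMDiffAt_matrix_det hG
  intro j
  have hsmooth : ContMDiffAt (𝓡 m) 𝓘(ℝ, ℝ) ∞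
      (fun x ↦ (∑ i, g.app X (E i) x * (G x).adjugate i j) / (G x).det) x₀ := by
    refine ContMDiffAt.div₀ ?_ hdetG hdet
    exact contMDiffAt_finsetSum fun i _ ↦ (hk i).mul (contMDiffAt_matrix_adjugate hG i j)
  refine hsmooth.congr_of_eventuallyEq ?_
  filter_upwards [hmem, hdetG.continuousAt.eventually_ne hdet] with x hx hx0
  rw [eq_div_iff hx0]
  have h1 : (fun i ↦ g.app X (E i) x) = Matrix.vecMul (c x) (G x) := by
    ext i
    simp only [app, Matrix.vecMul, dotProduct]
    conv_lhs => rw [eq_sum_coordFrame hx X]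
    rw [map_sum, sum_apply]
    refine Finset.sum_congr rfl fun k _ ↦ ?_
    rw [map_smul]
    rfl
  have h2 := congrFun (congrArg (fun w ↦ Matrix.vecMul w (G x).adjugate) h1) j
  simp only [Matrix.vecMul_vecMul, Matrix.mul_adjugate, Matrix.vecMul_smul, Matrix.vecMul_one] at h2
  simp only [Matrix.vecMul, dotProduct, Pi.smul_apply, smul_eq_mul] at h2
  rw [h2, mul_comm]

end PseudoMetric
end Metric
-- The Levi-Civita calculus of a pseudo-Riemannian manifold.
section Calculus

open Filter Topology

variable {m : ℕ} {M : Type*} [TopologicalSpace M] [ChartedSpace (EuclideanSpace ℝ (Fin m)) M]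
  [IsManifold (𝓡 m) ∞ M]

theorem mvfderiv_congr {f f' : M → ℝ} {x : M} (h : f =ᶠ[𝓝 x] f') :
    mvfderiv (𝓡 m) f x = mvfderiv (𝓡 m) f' x := by
  ext v
  exact congr($(h.mfderiv_eq (I := 𝓡 m) (I' := 𝓘(ℝ, ℝ))) v)

namespace PseudoMetric

variable (g : PseudoMetric m M)

/-- `∇` depends only on germs: the Koszul expressions agree for every `Z`, so `Classical.epsilon`
receives the same predicate. This covers fields that are smooth only near the point. -/
theorem nabla_congr {X X' Y Y' : VField m M} {x : M} (hX : ∀ᶠ y in 𝓝 x, X y = X' y)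
    (hY : ∀ᶠ y in 𝓝 x, Y y = Y' y) : g.nabla X Y x = g.nabla X' Y' x := by
  have h : (fun Z ↦ g.koszul X Y Z x) = fun Z ↦ g.koszul X' Y' Z x := by
    funext Z
    have hZ : Z =ᶠ[𝓝 x] Z := .rfl
    have e1 : g.app Y Z =ᶠ[𝓝 x] g.app Y' Z := by
      filter_upwards [hY] with y hy
      simp only [app, hy]
    have e2 : g.app X Z =ᶠ[𝓝 x] g.app X' Z := by
      filter_upwards [hX] with y hy
      simp only [app, hy]
    have e3 : g.app X Y =ᶠ[𝓝 x] g.app X' Y' := by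
      filter_upwards [hX, hY] with y hy hy'
      simp only [app, hy, hy']
    have e4 := EventuallyEq.mlieBracket_vectorField_eq (I := 𝓡 m) hX hY
    have e5 := EventuallyEq.mlieBracket_vectorField_eq (I := 𝓡 m) hX hZ
    have e6 := EventuallyEq.mlieBracket_vectorField_eq (I := 𝓡 m) hY hZ
    simp only [koszul, dirDeriv, app, bracket, mvfderiv_congr e1, mvfderiv_congr e2,
      mvfderiv_congr e3, e4, e5, e6, hX.self_of_nhds, hY.self_of_nhds]
  have h' (Z : VField m M) := congrFun h Z
  simp only [nabla, h']

/-- The metric on smooth vector fields. -/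
def appLin : SmoothVF m M →ₗ[SmoothFn m M] SmoothVF m M →ₗ[SmoothFn m M] SmoothFn m M :=
  LinearMap.mk₂ _ (fun X Y ↦ ⟨g.app X Y, fun x ↦ g.contMDiffAt_app (X.contMDiff x) (Y.contMDiff x)⟩)
    (fun X X' Y ↦ by
      ext x
      change g.val x (X x + X' x) (Y x) = g.val x (X x) (Y x) + g.val x (X' x) (Y x)
      rw [map_add]; rfl)
    (fun f X Y ↦ by
      ext x
      change g.val x (f x • X x) (Y x) = f x * g.val x (X x) (Y x)
      rw [map_smul]; rfl)
    (fun X Y Y' ↦ by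
      ext x
      exact map_add (g.val x (X x)) (Y x) (Y' x))
    (fun f X Y ↦ by
      ext x
      exact map_smul (g.val x (X x)) (f x) (Y x))

variable [T2Space M]

/-- The Levi-Civita derivative of smooth vector fields. -/
def nablaField (X Y : SmoothVF m M) : SmoothVF m M where
  toFun := g.nabla X Y
  contMDiff_toFun := by
    refine g.smoothField_of_app fun Z ↦ ?_
    let k : SmoothFn m M := SmoothVF.derivation X (g.appLin Y Z)
      + SmoothVF.derivation Y (g.appLin X Z) - SmoothVF.derivation Z (g.appLin X Y)
      + g.appLin ⁅X, Y⁆ Z - g.appLin ⁅X, Z⁆ Y - g.appLin ⁅Y, Z⁆ X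
    have h (x : M) : g.app (g.nabla X Y) Z x = 2⁻¹ * k x := by
      have h1 := g.nabla_spec (X.diffFieldAt x) (Y.diffFieldAt x) (Z.diffFieldAt x)
      have h2 : k x = g.koszul X Y Z x := rfl
      rw [app, h2, ← h1]
      ring
    rw [show g.app (g.nabla X Y) Z = fun x ↦ 2⁻¹ * k x from funext h]
    exact contMDiff_const.mul k.contMDiff

/-- The calculus of smooth vector fields on a pseudo-Riemannian manifold. -/
def calculus : LeviCivitaCalculus (SmoothFn m M) (SmoothVF m M) where
  D := SmoothVF.derivation
  lie_smul := SmoothVF.lie_smul'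
  D_lie := SmoothVF.derivation_lie
  g := g.appLin
  g_comm X Y := by
    ext x
    exact g.symm x _ _
  g_nondeg X h := by
    ext x : 1
    refine g.nondegenerate x _ fun v ↦ ?_
    obtain ⟨Y, rfl⟩ := exists_smoothVF_apply_eq v
    exact congrArg (fun f : SmoothFn m M ↦ f x) (h Y)
  nabla := g.nablaField
  koszul X Y Z := by
    ext x
    rw [two_mul]
    exact (two_mul (g.val x (g.nabla X Y x) (Z x))).symm.trans
      (g.nabla_spec (X.diffFieldAt x) (Y.diffFieldAt x) (Z.diffFieldAt x))
  tr := fieldTraceLinear m M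
  tr_comp_comm := fieldTrace_comp_comm
  tr_smulRight := fieldTrace_smulRight
  tr_adjoint S T h := by
    ext x
    refine trace_eq_of_adjoint ((ContinuousLinearMap.coeLM ℝ).comp (g.val x).toLinearMap)
      (g.nondegenerate x) _ _ fun u v ↦ ?_
    obtain ⟨X, rfl⟩ := exists_smoothVF_apply_eq u
    obtain ⟨Y, rfl⟩ := exists_smoothVF_apply_eq v
    rw [evalEnd_apply, evalEnd_apply]
    exact congrArg (fun f : SmoothFn m M ↦ f x) (h X Y)
  D_tr := derivation_fieldTrace

/-- The local extensions are replaced by global smooth fields with the same germs; tensoriality then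
allows each of these to be exchanged for any field with the same value at `x`. -/
theorem curvatureAt_eq (X Y Z : SmoothVF m M) (x : M) :
    g.curvatureAt x (X x) (Y x) (Z x) = g.calculus.curv X Y Z x := by
  obtain ⟨X', hX⟩ := exists_smoothVF_extend (X x)
  obtain ⟨Y', hY⟩ := exists_smoothVF_extend (Y x)
  obtain ⟨Z', hZ⟩ := exists_smoothVF_extend (Z x)
  have eX : X' x = X x := hX.self_of_nhds.trans (extend_apply_self ..)
  have eY : Y' x = Y x := hY.self_of_nhds.trans (extend_apply_self ..)
  have eZ : Z' x = Z x := hZ.self_of_nhds.trans (extend_apply_self ..)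
  have h1 : g.curvatureAt x (X x) (Y x) (Z x) = g.calculus.curv X' Y' Z' x := by
    have hX' := hX.mono fun _ h ↦ h.symm
    have hY' := hY.mono fun _ h ↦ h.symm
    have hZ' := hZ.mono fun _ h ↦ h.symm
    have hYZ := (hY'.eventually_nhds.and hZ'.eventually_nhds).mono fun y h ↦
      g.nabla_congr h.1 h.2
    have hXZ := (hX'.eventually_nhds.and hZ'.eventually_nhds).mono fun y h ↦
      g.nabla_congr h.1 h.2
    have hXY := (hX'.eventually_nhds.and hY'.eventually_nhds).mono fun y h ↦
      EventuallyEq.mlieBracket_vectorField_eq (I := 𝓡 m) h.1 h.2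
    rw [curvatureAt, curvature, g.nabla_congr hX' hYZ, g.nabla_congr hY' hXZ,
      g.nabla_congr hXY hZ']
    rfl
  have h2 : g.calculus.curv X' Y' Z' x = g.calculus.curv X Y' Z' x :=
    eq_of_apply_eq (x := x) ⟨⟨fun W ↦ g.calculus.curv W Y' Z' x, by
      simpa using congr($(g.calculus.curv_smul_left 0 0 Y' Z') x)⟩,
      fun W W' ↦ congr($(g.calculus.curv_add_left W W' Y' Z') x)⟩
      (fun f W ↦ congr($(g.calculus.curv_smul_left f W Y' Z') x)) eX
  have h3 : g.calculus.curv X Y' Z' x = g.calculus.curv X Y Z' x :=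
    eq_of_apply_eq (x := x) ⟨⟨fun W ↦ g.calculus.curv X W Z' x, by
      simpa using congr($(g.calculus.curv_smul_mid 0 X 0 Z') x)⟩,
      fun W W' ↦ congr($(g.calculus.curv_add_mid X W W' Z') x)⟩
      (fun f W ↦ congr($(g.calculus.curv_smul_mid f X W Z') x)) eY
  have h4 : g.calculus.curv X Y Z' x = g.calculus.curv X Y Z x :=
    eq_of_apply_eq (x := x) ⟨⟨fun W ↦ g.calculus.curv X Y W x, by
      simpa using congr($(g.calculus.curv_smul_right 0 X Y 0) x)⟩,
      fun W W' ↦ congr($(g.calculus.curv_add_right X Y W W') x)⟩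
      (fun f W ↦ congr($(g.calculus.curv_smul_right f X Y W) x)) eZ
  rw [h1, h2, h3, h4]

theorem ricci_eq (Y Z : SmoothVF m M) (x : M) :
    g.ricci x (Y x) (Z x) = g.calculus.ricci Y Z x := by
  have h : g.calculus.ricci Y Z x = LinearMap.trace ℝ _ (evalEnd (g.calculus.curvEnd Y Z) x) := rfl
  rw [h, LinearMap.trace_eq_matrix_trace ℝ (tangentBasis x), Matrix.trace, ricci]
  refine Finset.sum_congr rfl fun i _ ↦ ?_
  rw [Matrix.diag_apply, LinearMap.toMatrix_apply, Module.Basis.coord_apply]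
  obtain ⟨X, hX⟩ := exists_smoothVF_apply_eq (tangentBasis x i)
  rw [← hX, evalEnd_apply, curvatureAt_eq]
  rfl

end PseudoMetric

end Calculus

/-! ### Pointwise paracontact identities and the para-Sasakian calculus. -/

namespace AlmostParacontactMetric

variable {n : ℕ} {M : Type*} [TopologicalSpace M]
  [ChartedSpace (EuclideanSpace ℝ (Fin (2 * n + 1))) M] [IsManifold (𝓡 (2 * n + 1)) ∞ M]
  (P : AlmostParacontactMetric n M)

/-- From `φ²ξ = 0`, the vector `φξ` is `η(φξ)ξ`; a further `φ` gives `η(φξ) φξ = 0`. -/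
theorem φ_ξ (x : M) : P.φ x (P.ξ x) = 0 := by
  have h1 : P.φ x (P.φ x (P.ξ x)) = 0 := by rw [P.φ_sq, P.η_ξ, one_smul, sub_self]
  have h2 := P.φ_sq x (P.φ x (P.ξ x))
  rw [h1, map_zero] at h2
  have h3 : P.φ x (P.ξ x) = P.η x (P.φ x (P.ξ x)) • P.ξ x := (sub_eq_zero.1 h2.symm)
  have h4 := congrArg (P.φ x) h3
  rw [h1, map_smul, eq_comm, smul_eq_zero] at h4
  rcases h4 with h4 | h4
  · rw [h3, h4, zero_smul]
  · exact h4

theorem val_ξ (x : M) (v : TangentSpace (𝓡 (2 * n + 1)) x) : P.g.val x v (P.ξ x) = P.η x v := by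
  have h := P.compatible x v (P.ξ x)
  rw [P.φ_ξ, map_zero, P.η_ξ] at h
  linarith

theorem η_φ (x : M) (v : TangentSpace (𝓡 (2 * n + 1)) x) : P.η x (P.φ x v) = 0 := by
  have h := P.compatible x (P.φ x v) (P.ξ x)
  -- Two readings of `φ³v` differ by `η(φv)ξ`.
  have h1 := P.φ_sq x (P.φ x v)
  rw [P.φ_sq x v, map_sub, map_smul, P.φ_ξ, smul_zero, sub_zero] at h1
  have h2 : P.η x (P.φ x v) • P.ξ x = 0 := sub_eq_self.1 h1.symm
  have h3 := congrArg (P.η x) h2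
  rwa [map_smul, P.η_ξ, smul_eq_mul, mul_one, map_zero] at h3

theorem val_φ (x : M) (u v : TangentSpace (𝓡 (2 * n + 1)) x) :
    P.g.val x (P.φ x u) v = -P.g.val x u (P.φ x v) := by
  have h := P.compatible x (P.φ x u) v
  rw [P.φ_sq, P.η_φ, zero_mul, add_zero, map_sub, map_smul, sub_apply, smul_apply,
    P.g.symm x (P.ξ x), P.val_ξ, P.η_φ, smul_zero, sub_zero] at h
  rw [h, neg_neg]

/-- The action of `φ` on smooth vector fields. -/
def φLin : SmoothVF (2 * n + 1) M →ₗ[SmoothFn (2 * n + 1) M] SmoothVF (2 * n + 1) M where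
  toFun X := ⟨applyEnd P.φ X, fun x ↦ ContMDiffAt.clm_bundle_apply (P.φ_contMDiff x)
    (X.contMDiff x)⟩
  map_add' X Y := by
    ext x : 1
    exact map_add (P.φ x) (X x) (Y x)
  map_smul' f X := by
    ext x : 1
    exact map_smul (P.φ x) (f x) (X x)

/-- The action of `η` on smooth vector fields. -/
def ηLin : SmoothVF (2 * n + 1) M →ₗ[SmoothFn (2 * n + 1) M] SmoothFn (2 * n + 1) M where
  toFun X := ⟨fun x ↦ P.η x (X x), fun x ↦ by
    have : ContMDiffAt (𝓡 (2 * n + 1)) ((𝓡 (2 * n + 1)).prod 𝓘(ℝ, ℝ)) ∞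
        (fun y ↦ Bundle.TotalSpace.mk' ℝ (E := Bundle.Trivial M ℝ) y (P.η y (X y))) x :=
      ContMDiffAt.clm_bundle_apply (F₁ := EuclideanSpace ℝ (Fin (2 * n + 1))) (b := fun y ↦ y)
        (P.η_contMDiff x) (X.contMDiff x)
    rw [Bundle.contMDiffAt_totalSpace] at this
    exact this.2⟩
  map_add' X Y := by
    ext x
    exact map_add (P.η x) (X x) (Y x)
  map_smul' f X := by
    ext x
    exact map_smul (P.η x) (f x) (X x)

/-- The calculus of smooth vector fields on a para-Sasakian manifold. -/
def calculus [T2Space M] (hP : P.IsParaSasakian) :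
    ParaSasakianCalculus (SmoothFn (2 * n + 1) M) (SmoothVF (2 * n + 1) M) n where
  toLeviCivitaCalculus := P.g.calculus
  φ := P.φLin
  ξ := ⟨P.ξ, P.ξ_smooth⟩
  η := P.ηLin
  φ_sq X := by
    ext x : 1
    exact P.φ_sq x (X x)
  φ_ξ := by
    ext x : 1
    exact P.φ_ξ x
  η_ξ := by
    ext x
    exact P.η_ξ x
  g_ξ X := by
    ext x
    exact P.val_ξ x (X x)
  g_φ X Y := by
    ext x
    exact P.val_φ x (X x) (Y x)
  nabla_φ X Y := by
    ext x : 1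
    have h := hP X Y X.contMDiff Y.contMDiff x
    rw [sub_eq_iff_eq_add, neg_smul] at h
    refine h.trans ?_
    change -(P.g.val x (X x) (Y x) • P.ξ x) + P.η x (Y x) • X x + P.φ x (P.g.nabla X Y x) =
      P.φ x (P.g.nabla X Y x) - P.g.val x (X x) (Y x) • P.ξ x + P.η x (Y x) • X x
    abel
  tr_id := by
    refine fieldTrace_id.trans ?_
    push_cast
    rfl

end AlmostParacontactMetric
end ParaSasaki

/-! ### Transfer of the soliton results to the manifold. -/

namespace ParaSasaki.AlmostParacontactMetric

variable {n : ℕ} {M : Type*} [TopologicalSpace M]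
  [ChartedSpace (EuclideanSpace ℝ (Fin (2 * n + 1))) M] [IsManifold (𝓡 (2 * n + 1)) ∞ M]
  [T2Space M] (P : AlmostParacontactMetric n M)

theorem const_apply {m : ℕ} {M : Type*} [TopologicalSpace M]
    [ChartedSpace (EuclideanSpace ℝ (Fin m)) M] (c : ℝ) (x : M) :
    algebraMap ℝ (SmoothFn m M) c x = c := rfl

theorem two_mul_apply {m : ℕ} {M : Type*} [TopologicalSpace M]
    [ChartedSpace (EuclideanSpace ℝ (Fin m)) M] (f : SmoothFn m M) (x : M) :
    (2 * f) x = 2 * f x := by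
  rw [two_mul, two_mul]
  rfl

/-- A conformal `η`-Ricci soliton gives a soliton of the calculus of smooth vector fields. -/
theorem isSoliton (hP : P.IsParaSasakian) (V : SmoothVF (2 * n + 1) M) {p lam μ Λ τ : ℝ}
    (hV : P.IsConformalEtaRicciSoliton V p lam μ)
    (hΛ : Λ = 2 * lam - (p + 2 / (2 * (n : ℝ) + 1))) (hτ : 2 * τ = 4 * n - Λ - 2 * μ) :
    (P.calculus hP).IsSoliton V (algebraMap ℝ _ Λ) (algebraMap ℝ _ μ) (algebraMap ℝ _ τ) where
  D_Λ X := Derivation.map_algebraMap _ _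
  D_μ X := Derivation.map_algebraMap _ _
  D_τ X := Derivation.map_algebraMap _ _
  two_τ := by
    have h := congrArg (algebraMap ℝ (SmoothFn (2 * n + 1) M)) hτ
    simpa [map_ofNat] using h
  lieMetric_eq X Y := by
    ext x
    have h := hV.2 X Y X.contMDiff Y.contMDiff x
    rw [← hΛ, P.g.ricci_eq] at h
    have e : (2 * (P.calculus hP).ricci X Y + algebraMap ℝ _ Λ * (P.calculus hP).g X Y
        + 2 * algebraMap ℝ _ μ * ((P.calculus hP).η X * (P.calculus hP).η Y)) x
        = 2 * P.g.calculus.ricci X Y x + Λ * P.g.val x (X x) (Y x)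
          + 2 * μ * (P.η x (X x) * P.η x (Y x)) := by
      rw [mul_assoc, mul_assoc, ContMDiffMap.coe_add, Pi.add_apply, ContMDiffMap.coe_add,
        Pi.add_apply, two_mul_apply, two_mul_apply]
      rfl
    change P.g.lieDeriv V X Y x = -((2 * (P.calculus hP).ricci X Y
      + algebraMap ℝ _ Λ * (P.calculus hP).g X Y
      + 2 * algebraMap ℝ _ μ * ((P.calculus hP).η X * (P.calculus hP).η Y)) x)
    rw [e]
    linarith

section Soliton

variable {P} {hP : P.IsParaSasakian} {V : SmoothVF (2 * n + 1) M} {Λ μ τ : ℝ}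

theorem ricciEq_of_isSoliton
    (h : (P.calculus hP).IsSoliton V (algebraMap ℝ _ Λ) (algebraMap ℝ _ μ) (algebraMap ℝ _ τ)) :
    P.RicciEq (fun _ ↦ -(Λ + τ) / 2) (fun _ ↦ -(2 * μ + τ) / 2) := by
  intro x u v
  obtain ⟨X, rfl⟩ := exists_smoothVF_apply_eq u
  obtain ⟨Y, rfl⟩ := exists_smoothVF_apply_eq v
  have h0 := h.two_mul_ricci X Y
  rw [two_mul ((P.calculus hP).ricci X Y), two_mul (algebraMap ℝ _ μ)] at h0
  have h1 := congrArg (fun f : SmoothFn (2 * n + 1) M ↦ f x) h0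
  simp only [ContMDiffMap.coe_sub, Pi.sub_apply, ContMDiffMap.coe_mul, Pi.mul_apply,
    ContMDiffMap.coe_neg, Pi.neg_apply, ContMDiffMap.coe_add, Pi.add_apply, const_apply] at h1
  change P.g.calculus.ricci X Y x + P.g.calculus.ricci X Y x =
    -(Λ + τ) * P.g.val x (X x) (Y x) - (μ + μ + τ) * (P.η x (X x) * P.η x (Y x)) at h1
  rw [P.g.ricci_eq]
  linarith

theorem lieDeriv_of_isSoliton
    (h : (P.calculus hP).IsSoliton V (algebraMap ℝ _ Λ) (algebraMap ℝ _ μ) (algebraMap ℝ _ τ))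
    (X Y : SmoothVF (2 * n + 1) M) (x : M) : P.g.lieDeriv V X Y x =
      τ * (P.g.val x (X x) (Y x) + P.η x (X x) * P.η x (Y x)) :=
  congrArg (fun f : SmoothFn (2 * n + 1) M ↦ f x) (h.lieMetric_eq_mul X Y)

theorem eq_zero_or_of_isSoliton [Nonempty M] (hn : 1 ≤ n)
    (h : (P.calculus hP).IsSoliton V (algebraMap ℝ _ Λ) (algebraMap ℝ _ μ) (algebraMap ℝ _ τ)) :
    τ = 0 ∨ Λ + τ = -4 := by
  have h1 : algebraMap ℝ (SmoothFn (2 * n + 1) M) (τ * (Λ + τ + 4) * (2 * n)) = 0 := by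
    simpa [map_ofNat] using h.mul_eq_zero
  have x : M := Classical.arbitrary M
  have h2 : τ * (Λ + τ + 4) * (2 * n) = 0 := congrArg (fun f : SmoothFn (2 * n + 1) M ↦ f x) h1
  have hn' : (2 * n : ℝ) ≠ 0 := by positivity
  rcases mul_eq_zero.1 ((mul_eq_zero.1 h2).resolve_right hn') with h3 | h3
  · exact .inl h3
  · exact .inr (by linarith)

theorem leavesPhiInvariant_of_isSoliton
    (h : (P.calculus hP).IsSoliton V (algebraMap ℝ _ Λ) (algebraMap ℝ _ μ) (algebraMap ℝ _ τ))
    (hΛ : Λ + τ = -4) : P.LeavesPhiInvariant V := by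
  intro X hX x
  have h1 : algebraMap ℝ (SmoothFn (2 * n + 1) M) Λ + algebraMap ℝ _ τ = -4 := by
    rw [← map_add, hΛ, map_neg, map_ofNat]
  have h2 := h.lie_φ h1 ⟨X, hX⟩
  exact sub_eq_zero.2 (congrArg (fun W : SmoothVF (2 * n + 1) M ↦ W x) h2)

end Soliton

end ParaSasaki.AlmostParacontactMetric

end

theorem theorem3p2 {n : ℕ} (hn : 1 ≤ n) {M : Type*} [TopologicalSpace M] [T2Space M] [Nonempty M]
    [ChartedSpace (EuclideanSpace ℝ (Fin (2 * n + 1))) M] [IsManifold (𝓡 (2 * n + 1)) ∞ M]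
    (P : ParaSasaki.AlmostParacontactMetric n M) (hP : P.IsParaSasakian)
    (V : ParaSasaki.VField (2 * n + 1) M) (p lam μ : ℝ)
    (hV : P.IsConformalEtaRicciSoliton V p lam μ) :
    P.IsEtaEinstein ∧
    (lam = p / 2 + 1 / (2 * (n : ℝ) + 1) + 2 * n - μ ∨
      lam = p / 2 + 1 / (2 * (n : ℝ) + 1) - 2 * n + μ - 4) ∧
    (lam = p / 2 + 1 / (2 * (n : ℝ) + 1) + 2 * n - μ →
      P.RicciEq (fun _ ↦ μ - 2 * n) (fun _ ↦ -μ) ∧ P.g.IsKilling V) ∧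
    (lam = p / 2 + 1 / (2 * (n : ℝ) + 1) - 2 * n + μ - 4 →
      P.RicciEq (fun _ ↦ 2) (fun _ ↦ -(2 * ((n : ℝ) + 1))) ∧ P.LeavesPhiInvariant V) := by

  let Vs : ParaSasaki.SmoothVF (2 * n + 1) M := ⟨V, hV.1⟩
  obtain ⟨Λ, hΛ⟩ : ∃ Λ : ℝ, Λ = 2 * lam - (p + 2 / (2 * (n : ℝ) + 1)) := ⟨_, rfl⟩
  obtain ⟨τ, hτ⟩ : ∃ τ : ℝ, 2 * τ = 4 * n - Λ - 2 * μ :=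
    ⟨(4 * n - Λ - 2 * μ) / 2, by ring⟩
  have h := P.isSoliton hP Vs hV hΛ hτ
  -- With `1/(2n+1)` as the only fraction, the remaining relations are linear: equality (1) reads `τ
  -- = 0` and equality (2) reads `Λ + τ = -4`.
  have hdiv : (2 : ℝ) / (2 * n + 1) = 2 * (1 / (2 * n + 1)) := by ring
  rw [hdiv] at hΛ
  have hric := ParaSasaki.AlmostParacontactMetric.ricciEq_of_isSoliton h
  refine ⟨⟨_, _, contMDiff_const, contMDiff_const, hric⟩, ?_, fun hl ↦ ⟨?_, fun X Y hX hY x ↦ ?_⟩,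
    fun hl ↦ ⟨?_, ?_⟩⟩
  · rcases ParaSasaki.AlmostParacontactMetric.eq_zero_or_of_isSoliton hn h with h0 | h0
    · left; linarith
    · right; linarith
  · intro x u v
    have ha : -(Λ + τ) / 2 = μ - 2 * n := by linarith
    have hb : -(2 * μ + τ) / 2 = -μ := by linarith
    rw [hric x u v, ha, hb]
  · have h0 : τ = 0 := by linarith
    refine (ParaSasaki.AlmostParacontactMetric.lieDeriv_of_isSoliton h ⟨X, hX⟩ ⟨Y, hY⟩ x).trans ?_
    rw [h0, zero_mul]
  · intro x u v
    have ha : -(Λ + τ) / 2 = 2 := by linarith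
    have hb : -(2 * μ + τ) / 2 = -(2 * ((n : ℝ) + 1)) := by linarith
    rw [hric x u v, ha, hb]
  · have h0 : Λ + τ = -4 := by linarith
    have h1 := ParaSasaki.AlmostParacontactMetric.leavesPhiInvariant_of_isSoliton h h0
    exact h1
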